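/- **Theorem 1.** Let $a<b$, $T>0$, $\gamma\neq 0$, $k\ge 0$ an integer, and $f(w)=\tfrac12w^2$. Suppose that the Ostrovsky–Vakhnenko equation, written as the system $$u_t+f(u)_x+\gamma v=0,\qquad v_x=u,$$ has a classical solution $(u,v)$ for $t\in[0,T]$, $x\in\mathbb R$, that is $(b-a)$-periodic in $x$, satisfies $\int_a^b v(x,t)\,dx=0$ for all $t\in[0,T]$, and has $u\in C^{k+1}([0,T]\times\mathbb R)$. For a partition $a=x_{1/2}<x_{3/2}<\dots<x_{N+1/2}=b$ with cells $I_j=[x_{j-1/2},x_{j+1/2}]$ let $h=\max_j(x_{j+1/2}-x_{j-1/2})$, let $P^k(I_j)$ be the polynomials of degree at most $k$ on $I_j$, and let $V_h^k$ be the space of functions that are in $P^k(I_j)$ on each $I_j$ and may jump at the nodes. At $x_{j+1/2}$ let $w^-$ and $w^+$ be the traces of $w\in V_h^k$ from $I_j$ and $I_{j+1}$, where $I_0=I_N$ and $I_{N+1}=I_1$ (periodicity). Let $(\cdot,\cdot)_{I_j}$ be the inner product of $L^2(I_j)$ and let $\langle\hat g,\phi\rangle_{I_j}=\hat g_{j+1/2}\phi^-_{j+1/2}-\hat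 g_{j-1/2}\phi^+_{j-1/2}$. The semi-discrete energy stable DG scheme is: $u_h(t),v_h(t)\in V_h^k$ for $t\in[0,T]$, $u_h$ differentiable in $t$, $\int_a^b v_h\,dx=0$, and for all $\phi,\varphi\in V_h^k$, all $j$ and all $t\in[0,T]$ $$((u_h)_t,\phi)_{I_j}+\langle\widehat{f(u_h)},\phi\rangle_{I_j}-(f(u_h),\phi_x)_{I_j}+\gamma(v_h,\phi)_{I_j}=0,\qquad \langle\widehat{v_h},\varphi\rangle_{I_j}-(v_h,\varphi_x)_{I_j}=(u_h,\varphi)_{I_j},$$ with $\widehat{v_h}=v_h^-$ if $\gamma>0$, $\widehat{v_h}=v_h^+$ if $\gamma<0$, and the Lax–Friedrichs flux $$\widehat{f(u_h)}=\tfrac12\big(f(u_h^+)+f(u_h^-)-\alpha(u_h^+-u_h^-)\big),\qquad \alpha=\max|f'|,$$ where the maximum may be the local one (over the values between $u_h^-$ and $u_h^+$), the global one (over all values of $u_h(t)$ on the cells), or $\alpha$ may be any number between these two, depending on $t$ and on the node. Let $\kappa>0$ and $C_0\ge0$. Then there are constants $C>0$ and $h_0>0$, depending only on $\gamma,a,b,T,k,u,v,\kappa,C_0$,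 such that for every partition with $h\le h_0$ that is regular, i.e. $h\le\kappa\,(x_{j+1/2}-x_{j-1/2})$ for all $j$, and every solution $(u_h,v_h)$ of the scheme whose initial value satisfies $\|\mathcal P u(\cdot,0)-u_h(\cdot,0)\|_{L^2(a,b)}\le C_0h^{k+1/2}$, where $\mathcal P$ is the $L^2$ projection onto $V_h^k$ (in particular for $u_h(\cdot,0)=\mathcal P u(\cdot,0)$), $$\|u(\cdot,t)-u_h(\cdot,t)\|_{L^2(a,b)}\le C\,h^{k+1/2}\qquad\text{for all }t\in[0,T].$$ -/

import Mathlib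

open Polynomial

noncomputable section

namespace OV

/-- The convective flux `f(u) = u² / 2`. -/
def f (w : ℝ) : ℝ := w ^ 2 / 2

/-- `(u, v)` is a classical solution on `[0, T]` of the periodic problem
`u_t + (u²/2)_x + γ v = 0`, `v_x = u` with period `b - a`, normalised by `∫_a^b v dx = 0`,
and `u` is of class `C^m` on `[0, T] × ℝ`. The first argument of `u`, `v` is time. -/
structure IsSmoothPeriodicSolution (γ a b T : ℝ) (m : ℕ) (u v : ℝ → ℝ → ℝ) : Prop where
  smooth : ContDiffOn ℝ (m : WithTop ℕ∞) (fun p : ℝ × ℝ => u p.1 p.2)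
    (Set.Icc 0 T ×ˢ Set.univ)
  periodic_u : ∀ t ∈ Set.Icc 0 T, Function.Periodic (u t) (b - a)
  periodic_v : ∀ t ∈ Set.Icc 0 T, Function.Periodic (v t) (b - a)
  balance : ∀ t ∈ Set.Icc 0 T, ∀ x : ℝ,
    derivWithin (fun s => u s x) (Set.Icc 0 T) t + deriv (fun y => f (u t y)) x + γ * v t x = 0
  potential : ∀ t ∈ Set.Icc 0 T, ∀ x : ℝ, HasDerivAt (v t) (u t x) x
  zero_mean : ∀ t ∈ Set.Icc 0 T, ∫ x in a..b, v t x = 0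

/-- A partition `a = x_{1/2} < x_{3/2} < ⋯ < x_{N+1/2} = b` into `N` cells. -/
structure Mesh (a b : ℝ) (N : ℕ) where
  node : Fin (N + 1) → ℝ
  strictMono : StrictMono node
  node_zero : node 0 = a
  node_last : node (Fin.last N) = b

namespace Mesh

variable {a b : ℝ} {N : ℕ}

/-- Left end point of cell `j`. -/
def left (M : Mesh a b N) (j : Fin N) : ℝ := M.node j.castSucc

/-- Right end point of cell `j`. -/
def right (M : Mesh a b N) (j : Fin N) : ℝ := M.node j.succ

/-- Length of cell `j`. -/
def width (M : Mesh a b N) (j : Fin N) : ℝ := M.right j - M.left j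

/-- Mesh size `h`, the largest cell length. -/
def size [NeZero N] (M : Mesh a b N) : ℝ := Finset.univ.sup' Finset.univ_nonempty M.width

/-- Regularity with constant `κ`: the largest cell length is at most `κ` times any cell length. -/
def IsRegular [NeZero N] (M : Mesh a b N) (κ : ℝ) : Prop := ∀ j, M.size ≤ κ * M.width j

/-- The space of piecewise polynomials of degree at most `k`. An element is given by its
polynomial on each cell; nothing is required at the interfaces. -/
def IsDG (k : ℕ) (w : Fin N → ℝ[X]) : Prop := ∀ j, (w j).natDegree ≤ k

/-- The trace `w⁻` at the right end point of cell `j`, taken from cell `j`. -/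
def traceMinus (M : Mesh a b N) (w : Fin N → ℝ[X]) (j : Fin N) : ℝ := (w j).eval (M.right j)

/-- The trace `w⁺` at the right end point of cell `j`, taken from the next cell. Addition in
`Fin N` is cyclic, so the cell after the last one is the first one (periodicity). -/
def tracePlus [NeZero N] (M : Mesh a b N) (w : Fin N → ℝ[X]) (j : Fin N) : ℝ :=
  (w (j + 1)).eval (M.left (j + 1))

/-- `⟨ĝ, φ⟩` on cell `j`, where `ĝ i` is the value of the flux at the right end point of
cell `i`, and hence `ĝ (j - 1)` its value at the left end point of cell `j` (cyclically). -/
def bdry [NeZero N] (M : Mesh a b N) (g : Fin N → ℝ) (φ : ℝ[X]) (j : Fin N) : ℝ :=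
  g j * φ.eval (M.right j) - g (j - 1) * φ.eval (M.left j)

/-- The `L²(a, b)` norm of `g - w` for a function `g` and a piecewise polynomial `w`. -/
def l2Dist (M : Mesh a b N) (g : ℝ → ℝ) (w : Fin N → ℝ[X]) : ℝ :=
  Real.sqrt (∑ j, ∫ x in M.left j..M.right j, (g x - (w j).eval x) ^ 2)

/-- The `L²(a, b)` norm of a piecewise polynomial. -/
def l2Norm (M : Mesh a b N) (w : Fin N → ℝ[X]) : ℝ :=
  Real.sqrt (∑ j, ∫ x in M.left j..M.right j, ((w j).eval x) ^ 2)

/-- `w` is the `L²` projection of `g` onto the piecewise polynomials of degree at most `k`. -/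
def IsL2Projection (M : Mesh a b N) (k : ℕ) (g : ℝ → ℝ) (w : Fin N → ℝ[X]) : Prop :=
  IsDG k w ∧ ∀ j, ∀ φ : ℝ[X], φ.natDegree ≤ k →
    ∫ x in M.left j..M.right j, ((w j).eval x - g x) * φ.eval x = 0

/-- The dissipative flux `v̂ = v⁻` for `γ > 0` and `v̂ = v⁺` for `γ < 0`. -/
def vFlux [NeZero N] (M : Mesh a b N) (γ : ℝ) (w : Fin N → ℝ[X]) (j : Fin N) : ℝ :=
  if 0 < γ then M.traceMinus w j else M.tracePlus w j

/-- The Lax–Friedrichs flux `(f(u⁺) + f(u⁻) - α (u⁺ - u⁻)) / 2` with coefficient `α j` at the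
right end point of cell `j`. -/
def lfFlux [NeZero N] (M : Mesh a b N) (α : Fin N → ℝ) (w : Fin N → ℝ[X]) (j : Fin N) : ℝ :=
  (f (M.tracePlus w j) + f (M.traceMinus w j)
    - α j * (M.tracePlus w j - M.traceMinus w j)) / 2

/-- Admissible Lax–Friedrichs coefficients `α = max |f'|`: at each interface `α` is at least
the maximum of `|f'|` between the two traces (the local choice) and at most the maximum of
`|f'|` over all values of `w` (the global choice). Both of these choices are admissible. -/
def IsLFCoeff [NeZero N] (M : Mesh a b N) (w : Fin N → ℝ[X]) (α : Fin N → ℝ) : Prop :=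
  ∀ j, (∀ z ∈ Set.uIcc (M.traceMinus w j) (M.tracePlus w j), |deriv f z| ≤ α j) ∧
    ∃ i, ∃ x ∈ Set.Icc (M.left i) (M.right i), α j ≤ |deriv f ((w i).eval x)|

/-- `(uh, vh)` solves the semi-discrete energy stable DG scheme on `[0, T]` with periodic
boundary conditions, the constraint `∫ vh = 0` and the Lax–Friedrichs coefficients `α`.
In `evolution`, `w` is the time derivative of `uh` on cell `j`. -/
structure IsSchemeSolution [NeZero N] (M : Mesh a b N) (γ T : ℝ) (k : ℕ)
    (α : ℝ → Fin N → ℝ) (uh vh : ℝ → Fin N → ℝ[X]) : Prop where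
  uh_mem : ∀ t ∈ Set.Icc 0 T, IsDG k (uh t)
  vh_mem : ∀ t ∈ Set.Icc 0 T, IsDG k (vh t)
  coeff : ∀ t ∈ Set.Icc 0 T, M.IsLFCoeff (uh t) (α t)
  evolution : ∀ t ∈ Set.Icc 0 T, ∀ j, ∃ w : ℝ[X],
    (∀ i, HasDerivWithinAt (fun s => (uh s j).coeff i) (w.coeff i) (Set.Icc 0 T) t) ∧
    ∀ φ : ℝ[X], φ.natDegree ≤ k →
      (∫ x in M.left j..M.right j, w.eval x * φ.eval x)
        + M.bdry (M.lfFlux (α t) (uh t)) φ j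
        - (∫ x in M.left j..M.right j, f ((uh t j).eval x) * φ.derivative.eval x)
        + γ * (∫ x in M.left j..M.right j, (vh t j).eval x * φ.eval x) = 0
  potential : ∀ t ∈ Set.Icc 0 T, ∀ j, ∀ φ : ℝ[X], φ.natDegree ≤ k →
    M.bdry (M.vFlux γ (vh t)) φ j
        - (∫ x in M.left j..M.right j, (vh t j).eval x * φ.derivative.eval x)
      = ∫ x in M.left j..M.right j, (uh t j).eval x * φ.eval x
  zero_mean : ∀ t ∈ Set.Icc 0 T, ∑ j, ∫ x in M.left j..M.right j, (vh t j).eval x = 0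

end Mesh

end OV

end

/-! ### Polynomials of bounded degree on an interval: inverse inequalities, approximation,
projection. -/

namespace OV

/-! The proof is an energy estimate for ξ = u_h - Pu, with ζ = v_h - Pv, where P is the cellwise L²
projection. The projection errors of u and v are at most ε = L h^(k+1) pointwise. Subtracting the
exact equation from the scheme and testing with ξ leaves cell terms, node terms and -γ(ζ, ξ).

Since f is quadratic, f(u + ξ) - f(u) = uξ + ξ²/2, and its product with ξ_x is the derivative of
uξ²/2 + ξ³/6 minus u_x ξ²/2. The cubic terms are thus moved to the nodes exactly, so no a priori
smallness of the error is needed. With J the jump of ξ, the node contributes -αJ²/2 + J³/12 plus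
terms containing projection errors; α dominates both traces of u_h, so J ≤ 2α + 2ε and the
dissipation wins (`interface_estimate`). The other cell terms are handled by orthogonality and
inverse inequalities (`volume_estimate`). Testing the potential equation with ζ reduces (ζ, ξ) to
node values, and the upwind flux makes -γ(ζ, ξ) dissipate the jumps of ζ (`potential_estimate`); ζ
itself need not be bounded.

Each node costs a multiple of ε² and there are O(1/h) nodes, so the total is O(h^(2k+1)): this is
where half an order is lost. The coefficient α is bounded only through |u_h|; its part coming from ξ
is absorbed into the energy (`energy_inequality`). Gronwall's inequality and the approximation error
of P finish the proof. -/

theorem integral_sq_eval_pos {p : ℝ[X]} (hp : p ≠ 0) {l r : ℝ} (hlr : l < r) :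
    0 < ∫ x in l..r, p.eval x ^ 2 := by
  have hc : Continuous fun x => p.eval x ^ 2 := by fun_prop
  refine intervalIntegral.integral_pos hlr hc.continuousOn (fun x _ => sq_nonneg _) ?_
  by_contra! h
  apply hp
  refine Polynomial.eq_zero_of_infinite_isRoot p ((Set.Icc_infinite hlr).mono fun x hx => ?_)
  exact pow_eq_zero_iff (two_ne_zero) |>.1 (le_antisymm (h x hx) (sq_nonneg _))

/-- The polynomial with prescribed coefficients up to degree `k`. -/
noncomputable def ofCoeffs {k : ℕ} (c : Fin (k + 1) → ℝ) : ℝ[X] := ∑ i, C (c i) * X ^ (i : ℕ)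

theorem eval_ofCoeffs {k : ℕ} (c : Fin (k + 1) → ℝ) (x : ℝ) :
    (ofCoeffs c).eval x = ∑ i, c i * x ^ (i : ℕ) := by
  simp [ofCoeffs, eval_finsetSum]

theorem natDegree_ofCoeffs_le {k : ℕ} (c : Fin (k + 1) → ℝ) : (ofCoeffs c).natDegree ≤ k := by
  refine natDegree_sum_le_of_forall_le _ _ fun i _ => ?_
  exact (natDegree_C_mul_X_pow_le _ _).trans (Nat.lt_succ_iff.1 i.2)

theorem coeff_ofCoeffs {k : ℕ} (c : Fin (k + 1) → ℝ) (i : Fin (k + 1)) :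
    (ofCoeffs c).coeff i = c i := by
  simp [ofCoeffs, coeff_X_pow, Fin.val_inj]

theorem coeff_ofCoeffs_of_lt {k : ℕ} (c : Fin (k + 1) → ℝ) {i : ℕ} (hi : k < i) :
    (ofCoeffs c).coeff i = 0 :=
  coeff_eq_zero_of_natDegree_lt ((natDegree_ofCoeffs_le c).trans_lt hi)

theorem ofCoeffs_coeff {k : ℕ} {p : ℝ[X]} (hp : p.natDegree ≤ k) :
    ofCoeffs (fun i : Fin (k + 1) => p.coeff i) = p := by
  conv_rhs => rw [p.as_sum_range_C_mul_X_pow' (Nat.lt_succ_iff.2 hp)]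
  rw [ofCoeffs, Finset.sum_range]

theorem eval_derivative_ofCoeffs {k : ℕ} (c : Fin (k + 1) → ℝ) (x : ℝ) :
    (ofCoeffs c).derivative.eval x = ∑ i : Fin (k + 1), c i * ((i : ℕ) * x ^ ((i : ℕ) - 1)) := by
  simp [ofCoeffs, eval_finsetSum, derivative_X_pow]

theorem abs_eval_ofCoeffs_le {k : ℕ} (c : Fin (k + 1) → ℝ) {x : ℝ} (hx : x ∈ Set.Icc (0 : ℝ) 1) :
    |(ofCoeffs c).eval x| ≤ (k + 1 : ℝ) ^ 2 * ‖c‖ ∧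
      |(ofCoeffs c).derivative.eval x| ≤ (k + 1 : ℝ) ^ 2 * ‖c‖ := by
  have hpow : ∀ n : ℕ, |x ^ n| ≤ 1 := fun n => by
    rw [abs_of_nonneg (pow_nonneg hx.1 n)]; exact pow_le_one₀ hx.1 hx.2
  have hsum : ∑ _i : Fin (k + 1), (k + 1 : ℝ) * ‖c‖ = (k + 1 : ℝ) ^ 2 * ‖c‖ := by
    simp; ring
  rw [eval_ofCoeffs, eval_derivative_ofCoeffs, ← hsum]
  constructor <;> refine (Finset.abs_sum_le_sum_abs _ _).trans (Finset.sum_le_sum fun i _ => ?_) <;>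
    rw [abs_mul, mul_comm] <;>
    refine mul_le_mul ?_ (norm_le_pi_norm c i) (abs_nonneg _) (by positivity)
  · exact (hpow i).trans (by norm_num)
  · rw [abs_mul, Nat.abs_cast]
    have : ((i : ℕ) : ℝ) ≤ k := by exact_mod_cast Nat.lt_succ_iff.1 i.2
    nlinarith [hpow ((i : ℕ) - 1), abs_nonneg (x ^ ((i : ℕ) - 1))]

/-- Equivalence of norms on polynomials of bounded degree, on the unit interval. -/
theorem exists_eval_sq_le_integral_unit (k : ℕ) :
    ∃ K > 0, ∀ p : ℝ[X], p.natDegree ≤ k → ∀ x ∈ Set.Icc (0 : ℝ) 1,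
      p.eval x ^ 2 ≤ K * ∫ y in (0 : ℝ)..1, p.eval y ^ 2 ∧
      p.derivative.eval x ^ 2 ≤ K * ∫ y in (0 : ℝ)..1, p.eval y ^ 2 := by
  -- `F` is continuous, homogeneous of degree 2 and positive on the compact unit sphere; its minimum
  -- there bounds the coefficients.
  let F : (Fin (k + 1) → ℝ) → ℝ := fun c => ∫ y in (0 : ℝ)..1, (ofCoeffs c).eval y ^ 2
  have hF : Continuous F := by
    refine intervalIntegral.continuous_parametric_intervalIntegral_of_continuous'
      (f := fun (c : Fin (k + 1) → ℝ) y => (ofCoeffs c).eval y ^ 2) ?_ 0 1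
    simp only [Function.uncurry_def, eval_ofCoeffs]
    fun_prop
  have hne : (Metric.sphere (0 : Fin (k + 1) → ℝ) 1).Nonempty :=
    NormedSpace.sphere_nonempty.2 zero_le_one
  obtain ⟨c₀, hc₀, hmin⟩ := (isCompact_sphere (0 : Fin (k + 1) → ℝ) 1).exists_isMinOn hne
    hF.continuousOn
  have hc₀' : ‖c₀‖ = 1 := by simpa using hc₀
  have hpos : 0 < F c₀ := by
    refine integral_sq_eval_pos (fun h => ?_) one_pos
    have : c₀ = 0 := by
      ext i; rw [← coeff_ofCoeffs c₀ i, h]; simp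
    simp [this] at hc₀'
  have hsmul : ∀ (s : ℝ) c, F (s • c) = s ^ 2 * F c := by
    intro s c
    simp only [F, ← intervalIntegral.integral_const_mul]
    congr 1; ext y
    simp only [eval_ofCoeffs, Pi.smul_apply, smul_eq_mul, mul_assoc, ← Finset.mul_sum]
    ring
  have hlow : ∀ c, F c₀ * ‖c‖ ^ 2 ≤ F c := by
    intro c
    rcases eq_or_ne c 0 with rfl | hc
    · have := hsmul 0 0
      simp at this; simp [this]
    have hn : 0 < ‖c‖ := norm_pos_iff.2 hc
    have h1 : F c₀ ≤ F (‖c‖⁻¹ • c) := hmin (by simp [norm_smul, hn.ne'])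
    rw [hsmul] at h1
    calc F c₀ * ‖c‖ ^ 2 ≤ (‖c‖⁻¹ ^ 2 * F c) * ‖c‖ ^ 2 := by gcongr
      _ = F c := by field_simp
  refine ⟨(k + 1 : ℝ) ^ 4 / F c₀, by positivity, fun p hp x hx => ?_⟩
  set c : Fin (k + 1) → ℝ := fun i => p.coeff i with hc
  have hpc : ofCoeffs c = p := ofCoeffs_coeff hp
  have hFc : F c = ∫ y in (0 : ℝ)..1, p.eval y ^ 2 := by simp only [F, hpc]
  have h1 := abs_eval_ofCoeffs_le c hx
  rw [hpc] at h1
  have key : ∀ z : ℝ, |z| ≤ (k + 1 : ℝ) ^ 2 * ‖c‖ → z ^ 2 ≤ (k + 1 : ℝ) ^ 4 / F c₀ * F c := by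
    intro z hz
    have h2 : z ^ 2 ≤ ((k + 1 : ℝ) ^ 2 * ‖c‖) ^ 2 := by
      rw [← sq_abs]; gcongr
    refine h2.trans ?_
    rw [div_mul_eq_mul_div, le_div_iff₀ hpos]
    calc _ = (k + 1 : ℝ) ^ 4 * (F c₀ * ‖c‖ ^ 2) := by ring
      _ ≤ _ := by gcongr; exact hlow c
  rw [← hFc]
  exact ⟨key _ h1.1, key _ h1.2⟩

/-- Inverse inequalities for polynomials of degree at most `k` on an interval. -/
theorem exists_inverse_inequality (k : ℕ) :
    ∃ K > 0, ∀ p : ℝ[X], p.natDegree ≤ k → ∀ l r : ℝ, l < r → ∀ x ∈ Set.Icc l r,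
      p.eval x ^ 2 * (r - l) ≤ K * ∫ y in l..r, p.eval y ^ 2 ∧
      p.derivative.eval x ^ 2 * (r - l) ^ 3 ≤ K * ∫ y in l..r, p.eval y ^ 2 := by
  obtain ⟨K, hK, h⟩ := exists_eval_sq_le_integral_unit k
  refine ⟨K, hK, fun p hp l r hlr x hx => ?_⟩
  have hd : 0 < r - l := sub_pos.2 hlr
  -- Pulling back to the unit interval: the chain rule factor r - l, squared, is the additional
  -- power in the derivative bound.
  set q : ℝ[X] := p.comp (C (r - l) * X + C l) with hq
  have hqe : ∀ s, q.eval s = p.eval ((r - l) * s + l) := by intro s; simp [hq]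
  have hqd : ∀ s, q.derivative.eval s = (r - l) * p.derivative.eval ((r - l) * s + l) := by
    intro s; simp [hq, derivative_comp]
  have hdeg : q.natDegree ≤ k := by
    refine natDegree_comp_le.trans ?_
    calc _ ≤ p.natDegree * 1 := by gcongr; exact natDegree_linear_le
      _ ≤ k := by simpa
  have hs : (x - l) / (r - l) ∈ Set.Icc (0 : ℝ) 1 :=
    ⟨div_nonneg (sub_nonneg.2 hx.1) hd.le, (div_le_one hd).2 (by linarith [hx.2])⟩
  have hxs : (r - l) * ((x - l) / (r - l)) + l = x := by field_simp; ring
  have h_scale : ∫ y in (0 : ℝ)..1, q.eval y ^ 2 = (r - l)⁻¹ * ∫ y in l..r, p.eval y ^ 2 := by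
    simp only [hqe]
    rw [intervalIntegral.integral_comp_mul_add (fun y => p.eval y ^ 2) hd.ne' l]
    simp
  have := h q hdeg _ hs
  rw [hqe, hqd, hxs, h_scale] at this
  constructor
  · calc _ ≤ (K * ((r - l)⁻¹ * ∫ y in l..r, p.eval y ^ 2)) * (r - l) := by gcongr; exact this.1
      _ = _ := by field_simp
  · calc _ = ((r - l) * p.derivative.eval x) ^ 2 * (r - l) := by ring
      _ ≤ (K * ((r - l)⁻¹ * ∫ y in l..r, p.eval y ^ 2)) * (r - l) := by gcongr; exact this.2
      _ = _ := by field_simp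

theorem exists_antiderivative (q : ℝ[X]) :
    ∃ Q : ℝ[X], Q.derivative = q ∧ Q.natDegree ≤ q.natDegree + 1 := by
  refine ⟨∑ i ∈ Finset.range (q.natDegree + 1), C (q.coeff i / (i + 1)) * X ^ (i + 1), ?_, ?_⟩
  · conv_rhs => rw [q.as_sum_range_C_mul_X_pow]
    rw [derivative_sum]
    refine Finset.sum_congr rfl fun i _ => ?_
    rw [derivative_C_mul_X_pow]
    have : (i : ℝ) + 1 ≠ 0 := by positivity
    simp [div_mul_cancel₀ _ this]
  · refine natDegree_sum_le_of_forall_le _ _ fun i hi => ?_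
    exact (natDegree_C_mul_X_pow_le _ _).trans (by simpa using hi)

/-- Polynomial approximation of order `k + 1`; `D i` is the `i`-th derivative of `D 0`. -/
theorem exists_polynomial_approx (k : ℕ) : ∀ (D : ℕ → ℝ → ℝ) (l r B : ℝ),
    (∀ i ≤ k, ∀ x ∈ Set.Icc l r, HasDerivAt (D i) (D (i + 1) x) x) →
    (∀ x ∈ Set.Icc l r, |D (k + 1) x| ≤ B) → l ≤ r →
    ∃ q : ℝ[X], q.natDegree ≤ k ∧ ∀ x ∈ Set.Icc l r, |D 0 x - q.eval x| ≤ B * (r - l) ^ (k + 1) := by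
  have mvt : ∀ (g g' : ℝ → ℝ) (l r A : ℝ), l ≤ r → (∀ x ∈ Set.Icc l r, HasDerivAt g (g' x) x) →
      (∀ x ∈ Set.Icc l r, |g' x| ≤ A) → ∀ x ∈ Set.Icc l r, |g x - g l| ≤ A * (r - l) := by
    intro g g' l r A hlr hg hA x hx
    have h0 : 0 ≤ A := (abs_nonneg _).trans (hA x hx)
    have := (convex_Icc l r).norm_image_sub_le_of_norm_hasDerivWithin_le
      (fun y hy => (hg y hy).hasDerivWithinAt) hA (Set.left_mem_Icc.2 hlr) hx
    refine this.trans ?_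
    rw [Real.norm_eq_abs, abs_of_nonneg (sub_nonneg.2 hx.1)]
    gcongr; exact hx.2
  induction k with
  | zero =>
    intro D l r B hD hB hlr
    refine ⟨C (D 0 l), by simp, fun x hx => ?_⟩
    simpa using mvt _ _ l r B hlr (hD 0 le_rfl) (by simpa using hB) x hx
  | succ k ih =>
    intro D l r B hD hB hlr
    -- The derivative is approximated first; its approximant is integrated and matched at l, and the
    -- mean value inequality gains one factor r - l.
    obtain ⟨q, hq, hqe⟩ := ih (fun i => D (i + 1)) l r B (fun i hi => hD (i + 1) (by omega)) hB hlr
    obtain ⟨Q, hQ, hQd⟩ := exists_antiderivative q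
    refine ⟨Q + C (D 0 l - Q.eval l), ?_, fun x hx => ?_⟩
    · rw [natDegree_add_C]; omega
    · have := mvt (fun y => D 0 y - Q.eval y) (fun y => D 1 y - q.eval y) l r _ hlr
        (fun y hy => (hD 0 (by omega) y hy).sub (hQ ▸ Q.hasDerivAt y)) hqe x hx
      simp only [eval_add, eval_C]
      calc _ = |D 0 x - Q.eval x - (D 0 l - Q.eval l)| := by congr 1; ring
        _ ≤ _ := this
        _ = _ := by ring

/-! ### The L² projection as the solution of a linear system with a fixed matrix. -/

/-- The Gram matrix of the monomials on `[l, r]`. -/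
noncomputable def gram (k : ℕ) (l r : ℝ) : Matrix (Fin (k + 1)) (Fin (k + 1)) ℝ :=
  Matrix.of fun i j => ∫ x in l..r, x ^ (j : ℕ) * x ^ (i : ℕ)

theorem gram_mulVec (k : ℕ) (l r : ℝ) (c : Fin (k + 1) → ℝ) (i : Fin (k + 1)) :
    (gram k l r).mulVec c i = ∫ x in l..r, (ofCoeffs c).eval x * x ^ (i : ℕ) := by
  simp only [Matrix.mulVec, dotProduct, gram, Matrix.of_apply, eval_ofCoeffs, Finset.sum_mul]
  rw [intervalIntegral.integral_finsetSum]
  · refine Finset.sum_congr rfl fun j _ => ?_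
    rw [mul_comm, ← intervalIntegral.integral_const_mul]
    simp only [mul_assoc]
  · intro j _
    exact (by fun_prop : Continuous fun x : ℝ => c j * x ^ (j : ℕ) * x ^ (i : ℕ)).intervalIntegrable _ _

theorem integral_mul_ofCoeffs {k : ℕ} {l r : ℝ} {g : ℝ → ℝ} (hg : IntervalIntegrable g MeasureTheory.volume l r)
    (c : Fin (k + 1) → ℝ) :
    ∫ x in l..r, g x * (ofCoeffs c).eval x = ∑ i, c i * ∫ x in l..r, g x * x ^ (i : ℕ) := by
  simp only [eval_ofCoeffs, Finset.mul_sum]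
  rw [intervalIntegral.integral_finsetSum]
  · refine Finset.sum_congr rfl fun j _ => ?_
    rw [← intervalIntegral.integral_const_mul]
    congr 1; ext x; ring
  · intro j _
    exact hg.mul_continuousOn (by fun_prop)

/-- A kernel vector would be the coefficient vector of a nonzero polynomial whose square has zero
integral. -/
theorem isUnit_gram (k : ℕ) {l r : ℝ} (hlr : l < r) : IsUnit (gram k l r) := by
  rw [← Matrix.mulVec_injective_iff_isUnit, ← Matrix.coe_mulVecLin, ← LinearMap.ker_eq_bot,
    LinearMap.ker_eq_bot']
  intro c hc
  by_contra hne
  have hp : ofCoeffs c ≠ 0 := fun h => hne (by ext i; rw [← coeff_ofCoeffs c i, h]; simp)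
  have := integral_sq_eval_pos hp hlr
  simp only [sq] at this
  rw [integral_mul_ofCoeffs ((ofCoeffs c).continuous.intervalIntegrable _ _)] at this
  simp only [← gram_mulVec] at this
  rw [Matrix.mulVecLin_apply] at hc
  simp [hc] at this

/-- The `L²(l, r)` projection of `g` onto polynomials of degree at most `k`. -/
noncomputable def proj (k : ℕ) (l r : ℝ) (g : ℝ → ℝ) : ℝ[X] :=
  ofCoeffs ((gram k l r)⁻¹.mulVec fun i => ∫ x in l..r, g x * x ^ (i : ℕ))

theorem natDegree_proj_le (k : ℕ) (l r : ℝ) (g : ℝ → ℝ) : (proj k l r g).natDegree ≤ k :=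
  natDegree_ofCoeffs_le _

/-- By linearity monomials suffice as test functions, and for them this is the Gram system that
defines `proj`. -/
theorem integral_proj_mul {k : ℕ} {l r : ℝ} (hlr : l < r) {g : ℝ → ℝ}
    (hg : IntervalIntegrable g MeasureTheory.volume l r) {φ : ℝ[X]} (hφ : φ.natDegree ≤ k) :
    ∫ x in l..r, (proj k l r g).eval x * φ.eval x = ∫ x in l..r, g x * φ.eval x := by
  rw [← ofCoeffs_coeff hφ, integral_mul_ofCoeffs ((proj k l r g).continuous.intervalIntegrable _ _),
    integral_mul_ofCoeffs hg]
  refine Finset.sum_congr rfl fun i _ => ?_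
  rw [proj, ← gram_mulVec, Matrix.mulVec_mulVec,
    Matrix.mul_nonsing_inv _ ((Matrix.isUnit_iff_isUnit_det _).1 (isUnit_gram k hlr)), Matrix.one_mulVec]

/-- The coefficients of the projection depend differentiably on a parameter if the moments do. -/
theorem hasDerivAt_coeff_proj {k : ℕ} {l r : ℝ} {g : ℝ → ℝ → ℝ} {g' : ℝ → ℝ} {t : ℝ}
    (h : ∀ i : ℕ, HasDerivAt (fun s => ∫ x in l..r, g s x * x ^ i) (∫ x in l..r, g' x * x ^ i) t)
    (i : ℕ) :
    HasDerivAt (fun s => (proj k l r (g s)).coeff i) ((proj k l r g').coeff i) t := by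
  rcases lt_or_ge k i with hi | hi
  · simp only [proj, coeff_ofCoeffs_of_lt _ hi]
    exact hasDerivAt_const _ _
  · obtain ⟨j, rfl⟩ : ∃ j : Fin (k + 1), (j : ℕ) = i := ⟨⟨i, by omega⟩, rfl⟩
    simp only [proj, coeff_ofCoeffs, Matrix.mulVec, dotProduct]
    exact HasDerivAt.fun_sum fun m _ => (h m).const_mul _

theorem continuousOn_coeff_proj {k : ℕ} {l r : ℝ} {g : ℝ → ℝ → ℝ} {s : Set ℝ}
    (h : ∀ i : ℕ, ContinuousOn (fun t => ∫ x in l..r, g t x * x ^ i) s) (i : ℕ) :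
    ContinuousOn (fun t => (proj k l r (g t)).coeff i) s := by
  rcases lt_or_ge k i with hi | hi
  · simp only [proj, coeff_ofCoeffs_of_lt _ hi]
    exact continuousOn_const
  · obtain ⟨j, rfl⟩ : ∃ j : Fin (k + 1), (j : ℕ) = i := ⟨⟨i, by omega⟩, rfl⟩
    simp only [proj, coeff_ofCoeffs, Matrix.mulVec, dotProduct]
    exact continuousOn_finsetSum _ fun m _ => continuousOn_const.mul (h m)

/-- The `L²` projection is quasi-optimal in the maximum norm. -/
theorem abs_sub_proj_le {k : ℕ} {K : ℝ}
    (hK : ∀ p : ℝ[X], p.natDegree ≤ k → ∀ l r : ℝ, l < r → ∀ x ∈ Set.Icc l r,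
      p.eval x ^ 2 * (r - l) ≤ K * ∫ y in l..r, p.eval y ^ 2)
    (hK0 : 0 ≤ K) {l r ε : ℝ} (hlr : l < r) {g : ℝ → ℝ} (hg : ContinuousOn g (Set.Icc l r))
    {q : ℝ[X]} (hq : q.natDegree ≤ k) (hε : ∀ x ∈ Set.Icc l r, |g x - q.eval x| ≤ ε)
    {x : ℝ} (hx : x ∈ Set.Icc l r) :
    |g x - (proj k l r g).eval x| ≤ (1 + √K) * ε := by
  have hε0 : 0 ≤ ε := (abs_nonneg _).trans (hε x hx)
  set p := proj k l r g with hp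
  have hpq : (p - q).natDegree ≤ k := (natDegree_sub_le _ _).trans (max_le (natDegree_proj_le _ _ _ _) hq)
  have hgi : IntervalIntegrable g MeasureTheory.volume l r :=
    ContinuousOn.intervalIntegrable (by rwa [Set.uIcc_of_le hlr.le])
  have hgq : ContinuousOn (fun y => g y - q.eval y) (Set.uIcc l r) := by
    rw [Set.uIcc_of_le hlr.le]; exact hg.sub q.continuous.continuousOn
  have hcpq : Continuous fun y => (p - q).eval y := (p - q).continuous
  -- `p - q` is itself an admissible test function, so `p` may be replaced by `g` in one factor.
  have h1 : ∫ y in l..r, (p - q).eval y ^ 2 = ∫ y in l..r, (g y - q.eval y) * (p - q).eval y := by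
    have := integral_proj_mul hlr hgi hpq
    rw [← hp] at this
    have e1 : ∫ y in l..r, (p - q).eval y ^ 2 =
        (∫ y in l..r, p.eval y * (p - q).eval y) - ∫ y in l..r, q.eval y * (p - q).eval y := by
      rw [← intervalIntegral.integral_sub]
      · congr 1; ext y; simp; ring
      · exact (p.continuous.mul hcpq).intervalIntegrable _ _
      · exact (q.continuous.mul hcpq).intervalIntegrable _ _
    rw [e1, this, ← intervalIntegral.integral_sub]
    · congr 1; ext y; ring
    · exact hgi.mul_continuousOn hcpq.continuousOn
    · exact (q.continuous.mul hcpq).intervalIntegrable _ _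
  have h2 : ∫ y in l..r, (g y - q.eval y) * (p - q).eval y ≤
      ∫ y in l..r, (ε ^ 2 / 2 + (p - q).eval y ^ 2 / 2) := by
    refine intervalIntegral.integral_mono_on hlr.le (hgq.mul hcpq.continuousOn).intervalIntegrable
      (Continuous.intervalIntegrable (by fun_prop) _ _) fun y hy => ?_
    have := hε y hy
    have h3 : (g y - q.eval y) ^ 2 ≤ ε ^ 2 := by rw [← sq_abs]; gcongr
    nlinarith [sq_nonneg (g y - q.eval y - (p - q).eval y)]
  rw [intervalIntegral.integral_add (by simp) (Continuous.intervalIntegrable (by fun_prop) _ _),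
    intervalIntegral.integral_const, intervalIntegral.integral_div, smul_eq_mul] at h2
  have h4 : ∫ y in l..r, (p - q).eval y ^ 2 ≤ (r - l) * ε ^ 2 := by linarith
  have hd : 0 < r - l := sub_pos.2 hlr
  have h5 : (p - q).eval x ^ 2 ≤ K * ε ^ 2 := by
    have := (hK _ hpq l r hlr x hx).trans (mul_le_mul_of_nonneg_left h4 hK0)
    refine le_of_mul_le_mul_right (this.trans_eq ?_) hd
    ring
  have h6 : |(p - q).eval x| ≤ √K * ε := by
    refine abs_le_of_sq_le_sq (h5.trans_eq ?_) (by positivity)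
    rw [mul_pow, Real.sq_sqrt hK0]
  calc |g x - p.eval x| = |(g x - q.eval x) - (p - q).eval x| := by congr 1; simp
    _ ≤ |g x - q.eval x| + |(p - q).eval x| := abs_sub _ _
    _ ≤ ε + √K * ε := add_le_add (hε x hx) h6
    _ = _ := by ring

end OV

/-! ### Periodic mesh: summation over cells and nodes. -/

namespace OV

namespace Mesh

variable {a b : ℝ} {N : ℕ} (M : Mesh a b N)

theorem left_lt_right (j : Fin N) : M.left j < M.right j :=
  M.strictMono (Fin.castSucc_lt_succ)

theorem width_pos (j : Fin N) : 0 < M.width j := sub_pos.2 (M.left_lt_right j)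

theorem cell_subset (j : Fin N) : Set.Icc (M.left j) (M.right j) ⊆ Set.Icc a b := by
  refine Set.Icc_subset_Icc ?_ ?_
  · refine M.node_zero.symm.trans_le ?_; exact M.strictMono.monotone (Fin.zero_le _)
  · refine le_trans ?_ M.node_last.le; exact M.strictMono.monotone (Fin.le_last _)

theorem sum_width : ∑ j, M.width j = b - a := by
  have h : ∀ (n : ℕ) (x : Fin (n + 1) → ℝ),
      ∑ j : Fin n, (x j.succ - x j.castSucc) = x (Fin.last n) - x 0 := by
    intro n x
    have := Fin.sum_univ_succ x
    rw [Fin.sum_univ_castSucc] at this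
    rw [Finset.sum_sub_distrib]
    linarith
  have := h N M.node
  rwa [M.node_zero, M.node_last] at this

variable [NeZero N]

theorem width_le_size (j : Fin N) : M.width j ≤ M.size :=
  Finset.le_sup' _ (Finset.mem_univ j)

theorem size_pos : 0 < M.size := (M.width_pos 0).trans_le (M.width_le_size 0)

/-- Regularity makes the number of nodes O(1/h), which fixes the price of a sum of ε² over the
nodes. -/
theorem card_mul_size_le {κ : ℝ} (h : M.IsRegular κ) : N * M.size ≤ κ * (b - a) := by
  rw [← M.sum_width, Finset.mul_sum]
  calc (N : ℝ) * M.size = ∑ _j : Fin N, M.size := by simp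
    _ ≤ _ := Finset.sum_le_sum fun j _ => h j

/-- A function with equal values at `a` and `b` is continuous across every interface. -/
theorem apply_left_succ {g : ℝ → ℝ} (hg : g a = g b) (j : Fin N) :
    g (M.left (j + 1)) = g (M.right j) := by
  obtain ⟨n, rfl⟩ : ∃ n, N = n + 1 := Nat.exists_eq_succ_of_ne_zero (NeZero.ne N)
  -- Only the wrap-around from b to a needs `hg`; at every other interface both arguments are the
  -- same node.
  rcases eq_or_ne j (Fin.last n) with rfl | hj
  · have h1 : M.left (Fin.last n + 1) = a := by simp [left, M.node_zero]
    have h2 : M.right (Fin.last n) = b := by simp [right, M.node_last]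
    rw [h1, h2, hg]
  · congr 1
    simp only [left, right]
    congr 1
    ext
    simp [Fin.val_add_one, hj]

theorem sum_shift (g : Fin N → ℝ) : ∑ j, g (j + 1) = ∑ j, g j :=
  Equiv.sum_comp (Equiv.addRight (1 : Fin N)) g

/-- A flux has one value per node, so regrouping the cell sums by nodes pairs it with the jump. -/
theorem sum_bdry (g : Fin N → ℝ) (w : Fin N → ℝ[X]) :
    ∑ j, M.bdry g (w j) j = -∑ j, g j * (M.tracePlus w j - M.traceMinus w j) := by
  have h : ∑ j, g (j - 1) * (w j).eval (M.left j) = ∑ j, g j * M.tracePlus w j := by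
    rw [← sum_shift]
    simp [tracePlus]
  simp only [bdry, Finset.sum_sub_distrib, h, mul_sub, traceMinus]
  ring

/-- Summation of boundary values of a cellwise defined quantity. -/
theorem sum_boundary (F : Fin N → ℝ → ℝ) :
    ∑ j, (F j (M.right j) - F j (M.left j)) =
      -∑ j, (F (j + 1) (M.left (j + 1)) - F j (M.right j)) := by
  simp only [Finset.sum_sub_distrib]
  rw [sum_shift fun j => F j (M.left j)]
  ring

end Mesh

/-! ### Node, cell and nonlocal contributions to the error. -/

/-- Entropy dissipation of the Lax–Friedrichs flux at an interface: `z` is the value of the exact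
solution, `x`, `y` are the traces of the projected error from the right and from the left. -/
theorem interface_estimate {z x y p m α ε : ℝ} (hε : 0 ≤ ε)
    (hp : |p| ≤ α) (hm : |m| ≤ α) (hpx : |z + x - p| ≤ ε) (hmy : |z + y - m| ≤ ε) :
    ((f p + f m - α * (p - m)) / 2 - f z) * (x - y) - z * (x ^ 2 - y ^ 2) / 2
      - (x ^ 3 - y ^ 3) / 6 ≤ 3 * α * ε ^ 2 + ε * (x - y) ^ 2 / 2 + ε ^ 3 / 4 := by
  have hα : 0 ≤ α := (abs_nonneg _).trans hp
  obtain ⟨s, hs⟩ : ∃ s, s = z + x - p := ⟨_, rfl⟩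
  obtain ⟨d, hd⟩ : ∃ d, d = z + y - m := ⟨_, rfl⟩
  rw [← hs] at hpx
  rw [← hd] at hmy
  set J := x - y with hJ
  have hx : x = p + s - z := by linarith
  have hy : y = m + d - z := by linarith
  have hJ' : J = p - m + (s - d) := by rw [hJ, hx, hy]; ring
  -- `s` and `d` are projection errors at the node. Apart from terms containing them, only the
  -- dissipation -αJ²/2 and the cubic remainder J³/12 are left.
  have hid : ((f p + f m - α * (p - m)) / 2 - f z) * J - z * (x ^ 2 - y ^ 2) / 2
      - (x ^ 3 - y ^ 3) / 6 = -(α / 2) * J ^ 2 + J ^ 2 * J / 12 + α / 2 * (J * (s - d))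
        - J * (p * s + m * d) / 2 - J * (s ^ 2 + d ^ 2) / 4 := by
    simp only [f]
    rw [hJ', hx, hy]
    ring
  rw [hid]
  -- An upper bound suffices, as J³ is harmful only for positive J. It gives J³/12 ≤ (α + ε)J²/6, so
  -- the dissipation -αJ²/3 survives.
  have habsJ : J ≤ 2 * α + 2 * ε := by
    rw [hJ']; linarith [le_abs_self p, neg_abs_le m, le_abs_self s, neg_abs_le d]
  have h1 : J ^ 2 * J ≤ J ^ 2 * (2 * α + 2 * ε) := by gcongr
  have h2 : J * (s - d) ≤ |J| * (2 * ε) := by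
    refine (le_abs_self _).trans ?_
    rw [abs_mul]; gcongr
    exact (abs_sub _ _).trans (by linarith)
  have h3 : -(J * (p * s + m * d)) ≤ |J| * (2 * (α * ε)) := by
    refine (neg_le_abs _).trans ?_
    rw [abs_mul]; gcongr
    refine (abs_add_le _ _).trans ?_
    rw [abs_mul, abs_mul, two_mul]
    gcongr
  have hs2 : s ^ 2 ≤ ε ^ 2 := by rw [← sq_abs]; gcongr
  have hd2 : d ^ 2 ≤ ε ^ 2 := by rw [← sq_abs]; gcongr
  have h4 : -(J * (s ^ 2 + d ^ 2)) ≤ |J| * (2 * ε ^ 2) := by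
    refine (neg_le_abs _).trans ?_
    rw [abs_mul, abs_of_nonneg (by positivity : 0 ≤ s ^ 2 + d ^ 2)]; gcongr
    linarith
  -- The weight 1/3 uses up exactly the surviving dissipation and produces the term 3αε².
  have h5 : 2 * (|J| * ε) ≤ J ^ 2 / 3 + 3 * ε ^ 2 := by
    nlinarith [sq_nonneg (|J| - 3 * ε), sq_abs J]
  have h6 : 2 * (|J| * ε) ≤ J ^ 2 + ε ^ 2 := by
    nlinarith [sq_nonneg (|J| - ε), sq_abs J]
  have h7 := mul_le_mul_of_nonneg_left h5 hα
  have h8 := mul_le_mul_of_nonneg_left h6 hε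
  have h9 : α * (J * (s - d)) ≤ α * (|J| * (2 * ε)) := by gcongr
  have h10 : 0 ≤ ε * J ^ 2 := by positivity
  clear_value J
  linarith

end OV

namespace OV

theorem sq_le_three_mul_of_abs_le {ρ x y z : ℝ} (h : |ρ| ≤ x + y + z) :
    ρ ^ 2 ≤ 3 * (x ^ 2 + y ^ 2 + z ^ 2) := by
  have h1 : ρ ^ 2 ≤ (x + y + z) ^ 2 := by rw [← sq_abs]; gcongr
  nlinarith [sq_nonneg (x - y), sq_nonneg (x - z), sq_nonneg (y - z)]

/-- Each term multiplying ξ' carries a factor d, because δ = O(d) and |η| ≤ ε ≤ cd. Young's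
inequality can therefore pair ξ' with d, as the inverse inequality requires, without leaving a
negative power of d. -/
theorem volume_pointwise {B c ε d η δ Ux : ℝ} (hd : 0 < d) (hB : 0 ≤ B) (hc : 0 ≤ c)
    (hδ : |δ| ≤ B * d) (hη : |η| ≤ ε) (hcε : ε ≤ c * d) (hUx : |Ux| ≤ B) (ξ ξ' : ℝ) :
    -(Ux * ξ ^ 2 / 2) + ξ' * (-δ * η - ξ * η + η ^ 2 / 2) ≤
      (B / 2 + 3 * c ^ 2 / 2) * ξ ^ 2 + d ^ 2 * ξ' ^ 2 / 2 + 3 / 2 * (B ^ 2 + c ^ 2) * ε ^ 2 := by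
  have hε0 : 0 ≤ ε := (abs_nonneg _).trans hη
  have h6 : -(Ux * ξ ^ 2 / 2) ≤ B / 2 * ξ ^ 2 := by
    nlinarith [neg_abs_le Ux, sq_nonneg ξ]
  obtain ⟨ρ, hρ⟩ : ∃ ρ, ρ = -δ * η - ξ * η + η ^ 2 / 2 := ⟨_, rfl⟩
  rw [← hρ]
  have h1 : |ρ| ≤ d * (B * ε) + d * (c * |ξ|) + d * (c * ε / 2) := by
    have e1 : |δ * η| ≤ (B * d) * ε := by
      rw [abs_mul]; gcongr
    have e2 : |ξ * η| ≤ |ξ| * (c * d) := by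
      rw [abs_mul]; gcongr; exact hη.trans hcε
    have e3 : η ^ 2 ≤ (c * d) * ε := by
      rw [← sq_abs, sq]; gcongr; exact hη.trans hcε
    have e4 := abs_le.1 e1
    have e5 := abs_le.1 e2
    have e6 := sq_nonneg η
    rw [abs_le]
    constructor <;> rw [hρ] <;> linarith
  have h2 := sq_le_three_mul_of_abs_le h1
  have h3 : ξ' * ρ ≤ (d ^ 2 * ξ' ^ 2 + ρ ^ 2 / d ^ 2) / 2 := by
    have := two_mul_le_add_sq (d * ξ') (ρ / d)
    rw [mul_pow, div_pow] at this
    have e' : 2 * (d * ξ') * (ρ / d) = 2 * (ξ' * ρ) := by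
      field_simp
    linarith
  have h4 : ρ ^ 2 / d ^ 2 ≤ 3 * (B ^ 2 * ε ^ 2 + c ^ 2 * ξ ^ 2 + c ^ 2 * ε ^ 2) := by
    rw [div_le_iff₀ (by positivity)]
    refine h2.trans ?_
    simp only [mul_pow, sq_abs, div_pow]
    have : 0 ≤ d ^ 2 * (c ^ 2 * ε ^ 2) := by positivity
    linarith
  linarith

/-- The volume terms of the error equation on one cell. -/
theorem volume_estimate {k : ℕ} {K : ℝ}
    (hK : ∀ p : ℝ[X], p.natDegree ≤ k → ∀ l r : ℝ, l < r → ∀ x ∈ Set.Icc l r,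
      p.derivative.eval x ^ 2 * (r - l) ^ 3 ≤ K * ∫ y in l..r, p.eval y ^ 2)
    {l r B c ε : ℝ} (hlr : l < r) {U Ux : ℝ → ℝ} (hU : ∀ x, HasDerivAt U (Ux x) x)
    (hUx : Continuous Ux) (hB : ∀ x ∈ Set.Icc l r, |Ux x| ≤ B) {p ξ : ℝ[X]}
    (hξ : ξ.natDegree ≤ k)
    (horth : ∀ φ : ℝ[X], φ.natDegree ≤ k → ∫ x in l..r, (U x - p.eval x) * φ.eval x = 0)
    (hε : ∀ x ∈ Set.Icc l r, |U x - p.eval x| ≤ ε) (hc : ε ≤ c * (r - l)) :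
    ∫ x in l..r, (f ((p + ξ).eval x) - f (U x)) * ξ.derivative.eval x ≤
      (U r * ξ.eval r ^ 2 / 2 + ξ.eval r ^ 3 / 6) - (U l * ξ.eval l ^ 2 / 2 + ξ.eval l ^ 3 / 6)
        + (B / 2 + K / 2 + 3 * c ^ 2 / 2) * (∫ x in l..r, ξ.eval x ^ 2)
        + 3 / 2 * (B ^ 2 + c ^ 2) * ε ^ 2 * (r - l) := by
  have hd : 0 < r - l := sub_pos.2 hlr
  have hUc : Continuous U := continuous_iff_continuousAt.2 fun x => (hU x).continuousAt
  have hl : l ∈ Set.Icc l r := ⟨le_rfl, hlr.le⟩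
  have hB0 : 0 ≤ B := (abs_nonneg _).trans (hB l hl)
  have hε0 : 0 ≤ ε := (abs_nonneg _).trans (hε l hl)
  have hc0 : 0 ≤ c := by
    by_contra! h
    nlinarith
  -- The derivative of Uξ²/2 + ξ³/6: it takes out the part of (f(U + ξ) - f(U))ξ' that the
  -- projection error does not touch, up to U_x ξ²/2.
  set G' : ℝ → ℝ := fun x => Ux x * ξ.eval x ^ 2 / 2 + U x * ξ.eval x * ξ.derivative.eval x
    + ξ.eval x ^ 2 * ξ.derivative.eval x / 2 with hG'
  have hG : ∀ x, HasDerivAt (fun x => U x * ξ.eval x ^ 2 / 2 + ξ.eval x ^ 3 / 6) (G' x) x := by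
    intro x
    have h1 := ξ.hasDerivAt x
    refine ((((hU x).mul (h1.pow 2)).div_const 2).add ((h1.pow 3).div_const 6)).congr_deriv ?_
    simp only [hG', Pi.pow_apply]
    push_cast
    ring
  have hG'c : Continuous G' := by fun_prop
  have hftc : ∫ x in l..r, G' x = (U r * ξ.eval r ^ 2 / 2 + ξ.eval r ^ 3 / 6)
      - (U l * ξ.eval l ^ 2 / 2 + ξ.eval l ^ 3 / 6) :=
    intervalIntegral.integral_eq_sub_of_hasDerivAt (fun x _ => hG x) (hG'c.intervalIntegrable _ _)
  -- This zero is added so that the projection error is multiplied by U - U(l) = O(r - l) instead of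
  -- U.
  have horth' : ∫ x in l..r, U l * ((U x - p.eval x) * ξ.derivative.eval x) = 0 := by
    rw [intervalIntegral.integral_const_mul, horth _ ((natDegree_derivative_le ξ).trans
      ((Nat.sub_le _ _).trans hξ)), mul_zero]
  have hfc : Continuous fun x => (f ((p + ξ).eval x) - f (U x)) * ξ.derivative.eval x := by
    simp only [f]; fun_prop
  have hoc : Continuous fun x => U l * ((U x - p.eval x) * ξ.derivative.eval x) := by fun_prop
  have hmain : ∫ x in l..r, ((f ((p + ξ).eval x) - f (U x)) * ξ.derivative.eval x - G' x
        + U l * ((U x - p.eval x) * ξ.derivative.eval x)) ≤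
      ∫ x in l..r, ((B / 2 + 3 * c ^ 2 / 2) * ξ.eval x ^ 2
        + (r - l)⁻¹ * (K / 2 * ∫ y in l..r, ξ.eval y ^ 2) + 3 / 2 * (B ^ 2 + c ^ 2) * ε ^ 2) := by
    refine intervalIntegral.integral_mono_on hlr.le 
      (((hfc.sub hG'c).add hoc).intervalIntegrable _ _)
      (Continuous.intervalIntegrable (by fun_prop) _ _) fun x hx => ?_
    have hη := hε x hx
    have hUl : |U x - U l| ≤ B * (r - l) := by
      have := (convex_Icc l r).norm_image_sub_le_of_norm_hasDerivWithin_le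
        (fun y _ => (hU y).hasDerivWithinAt) hB hl hx
      refine this.trans ?_
      rw [Real.norm_eq_abs, abs_of_nonneg (sub_nonneg.2 hx.1)]
      gcongr; exact hx.2
    set η := U x - p.eval x with hηdef
    have hid : (f ((p + ξ).eval x) - f (U x)) * ξ.derivative.eval x - G' x
        + U l * (η * ξ.derivative.eval x)
        = -(Ux x * ξ.eval x ^ 2 / 2) + ξ.derivative.eval x *
          (-(U x - U l) * η - ξ.eval x * η + η ^ 2 / 2) := by
      simp only [hG', f, eval_add, hηdef]
      ring
    rw [hid]
    -- The inverse inequality bounds ξ' by a constant on the cell; integrating that constant cancels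
    -- (r - l)⁻¹.
    have h5 : (r - l) ^ 2 * ξ.derivative.eval x ^ 2 ≤ (r - l)⁻¹ * (K * ∫ y in l..r, ξ.eval y ^ 2) := by
      rw [le_inv_mul_iff₀ hd]
      exact le_trans (le_of_eq (by ring)) (hK ξ hξ l r hlr x hx)
    have h7 : (r - l)⁻¹ * (K * ∫ y in l..r, ξ.eval y ^ 2) / 2
        = (r - l)⁻¹ * (K / 2 * ∫ y in l..r, ξ.eval y ^ 2) := by ring
    have := volume_pointwise hd hB0 hc0 hUl hη hc (hB x hx) (ξ.eval x) (ξ.derivative.eval x)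
    linarith
  have hsc : Continuous fun x => (f ((p + ξ).eval x) - f (U x)) * ξ.derivative.eval x - G' x :=
    hfc.sub hG'c
  rw [intervalIntegral.integral_add (hsc.intervalIntegrable _ _) (hoc.intervalIntegrable _ _),
    intervalIntegral.integral_sub (hfc.intervalIntegrable _ _) (hG'c.intervalIntegrable _ _),
    horth', hftc] at hmain
  have hrhs : ∫ x in l..r, ((B / 2 + 3 * c ^ 2 / 2) * ξ.eval x ^ 2
        + (r - l)⁻¹ * (K / 2 * ∫ y in l..r, ξ.eval y ^ 2) + 3 / 2 * (B ^ 2 + c ^ 2) * ε ^ 2)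
      = (B / 2 + K / 2 + 3 * c ^ 2 / 2) * (∫ x in l..r, ξ.eval x ^ 2)
        + 3 / 2 * (B ^ 2 + c ^ 2) * ε ^ 2 * (r - l) := by
    rw [intervalIntegral.integral_add (Continuous.intervalIntegrable (by fun_prop) _ _) (by simp),
      intervalIntegral.integral_add (Continuous.intervalIntegrable (by fun_prop) _ _) (by simp),
      intervalIntegral.integral_const_mul, intervalIntegral.integral_const,
      intervalIntegral.integral_const]
    simp only [smul_eq_mul]
    field_simp
    ring
  rw [hrhs] at hmain
  linarith

namespace Mesh

variable {a b : ℝ} {N : ℕ} [NeZero N] (M : Mesh a b N)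

/-- The error of the nonlocal term is controlled by the dissipation of the upwind flux. -/
theorem potential_estimate {γ ε : ℝ} {k : ℕ} {U V : ℝ → ℝ} (hUc : Continuous U)
    (hV : ∀ x, HasDerivAt V (U x) x) (hVab : V a = V b) {uh vh p q : Fin N → ℝ[X]}
    (hvh : IsDG k vh) (hq : IsDG k q)
    (hp_orth : ∀ j, ∀ φ : ℝ[X], φ.natDegree ≤ k →
      ∫ x in M.left j..M.right j, (U x - (p j).eval x) * φ.eval x = 0)
    (hq_orth : ∀ j, ∀ φ : ℝ[X], φ.natDegree ≤ k →
      ∫ x in M.left j..M.right j, (V x - (q j).eval x) * φ.eval x = 0)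
    (hε : ∀ j, ∀ x ∈ Set.Icc (M.left j) (M.right j), |V x - (q j).eval x| ≤ ε)
    (hscheme : ∀ j, ∀ φ : ℝ[X], φ.natDegree ≤ k →
      M.bdry (M.vFlux γ vh) φ j
          - (∫ x in M.left j..M.right j, (vh j).eval x * φ.derivative.eval x)
        = ∫ x in M.left j..M.right j, (uh j).eval x * φ.eval x) :
    -(γ * ∑ j, ∫ x in M.left j..M.right j, (vh j - q j).eval x * (uh j - p j).eval x) ≤
      |γ| / 2 * (N * ε ^ 2) := by
  have hVc : Continuous V := continuous_iff_continuousAt.2 fun x => (hV x).continuousAt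
  set ζ : Fin N → ℝ[X] := vh - q with hζ
  have hζj : ∀ j, ζ j = vh j - q j := fun j => rfl
  have hdeg : ∀ j, (ζ j).natDegree ≤ k := fun j =>
    (natDegree_sub_le _ _).trans (max_le (hvh j) (hq j))
  -- The discrete and the exact potential equation are both tested with ζ; orthogonality removes the
  -- projection errors inside the cell, so only boundary values remain.
  have hcell : ∀ j, ∫ x in M.left j..M.right j, (vh j - q j).eval x * (uh j - p j).eval x =
      M.bdry (fun i => M.vFlux γ vh i - V (M.right i)) (ζ j) j
        - ((ζ j).eval (M.right j) ^ 2 / 2 - (ζ j).eval (M.left j) ^ 2 / 2) := by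
    intro j
    set l := M.left j
    set r := M.right j
    have hVl : V l = V (M.right (j - 1)) := by
      have := M.apply_left_succ hVab (j - 1)
      rwa [sub_add_cancel] at this
    have e1 := hscheme j _ (hdeg j)
    have e2 := hp_orth j _ (hdeg j)
    have e3 := hq_orth j _ ((natDegree_derivative_le (ζ j)).trans ((Nat.sub_le _ _).trans (hdeg j)))
    have e4 : ∫ x in l..r, (U x * (ζ j).eval x + V x * (ζ j).derivative.eval x) =
        V r * (ζ j).eval r - V l * (ζ j).eval l :=
      intervalIntegral.integral_eq_sub_of_hasDerivAt
        (f := fun x => V x * (ζ j).eval x)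
        (fun x _ => (hV x).mul ((ζ j).hasDerivAt x))
        (Continuous.intervalIntegrable (by fun_prop) _ _)
    have e5 : ∫ x in l..r, (ζ j).eval x * (ζ j).derivative.eval x =
        (ζ j).eval r ^ 2 / 2 - (ζ j).eval l ^ 2 / 2 :=
      intervalIntegral.integral_eq_sub_of_hasDerivAt
        (f := fun x => (ζ j).eval x ^ 2 / 2)
        (fun x _ => ((((ζ j).hasDerivAt x).pow 2).div_const 2).congr_deriv (by push_cast; ring))
        (Continuous.intervalIntegrable (by fun_prop) _ _)
    have e6 : ∫ x in l..r, (vh j - q j).eval x * (uh j - p j).eval x =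
        (∫ x in l..r, (uh j).eval x * (ζ j).eval x)
        + (∫ x in l..r, (U x - (p j).eval x) * (ζ j).eval x)
        - (∫ x in l..r, (U x * (ζ j).eval x + V x * (ζ j).derivative.eval x))
        + (∫ x in l..r, (vh j).eval x * (ζ j).derivative.eval x)
        - (∫ x in l..r, (ζ j).eval x * (ζ j).derivative.eval x)
        + (∫ x in l..r, (V x - (q j).eval x) * (ζ j).derivative.eval x) := by
      rw [← intervalIntegral.integral_add, ← intervalIntegral.integral_sub,
        ← intervalIntegral.integral_add, ← intervalIntegral.integral_sub,
        ← intervalIntegral.integral_add]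
      · congr 1; ext x; simp only [hζj, eval_sub]; ring
      all_goals exact Continuous.intervalIntegrable (by fun_prop) _ _
    rw [e6, e4, e5, e2, e3, ← e1, hVl]
    simp only [bdry]
    ring
  rw [Finset.sum_congr rfl fun j _ => hcell j, Finset.sum_sub_distrib, sum_bdry,
    M.sum_boundary fun j x => (ζ j).eval x ^ 2 / 2, ← Finset.sum_neg_distrib,
    ← Finset.sum_neg_distrib, ← Finset.sum_sub_distrib, Finset.mul_sum, ← Finset.sum_neg_distrib]
  calc _ ≤ ∑ _j : Fin N, |γ| / 2 * ε ^ 2 := Finset.sum_le_sum fun j _ => ?_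
    _ = _ := by simp; ring
  have hP : |V (M.right j) - (q (j + 1)).eval (M.left (j + 1))| ≤ ε := by
    rw [← M.apply_left_succ hVab]
    exact hε _ _ ⟨le_rfl, (M.left_lt_right _).le⟩
  have hM : |V (M.right j) - (q j).eval (M.right j)| ≤ ε :=
    hε _ _ ⟨(M.left_lt_right _).le, le_rfl⟩
  have key : ∀ z d : ℝ, |z| ≤ ε → z * d ≤ d ^ 2 / 2 + ε ^ 2 / 2 := by
    intro z d hz
    have : z ^ 2 ≤ ε ^ 2 := by rw [← sq_abs]; gcongr
    nlinarith [sq_nonneg (z - d)]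
  simp only [tracePlus, traceMinus, vFlux, hζj, eval_sub]
  set P := (vh (j + 1)).eval (M.left (j + 1))
  set Q := (q (j + 1)).eval (M.left (j + 1))
  set P' := (vh j).eval (M.right j)
  set Q' := (q j).eval (M.right j)
  -- With D the jump of ζ, the upwind trace turns the quadratic terms into -|γ|D²/2. This absorbs D
  -- times the projection error of V on the side from which the flux is taken.
  split_ifs with hγ
  · rw [abs_of_pos hγ]
    have := key _ (-(P - Q - (P' - Q'))) hM
    nlinarith
  · rw [not_lt] at hγ
    rw [abs_of_nonpos hγ]
    have := key _ (P - Q - (P' - Q')) hP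
    nlinarith

end Mesh

end OV

/-! ### The error equation and the differential inequality for the energy. -/

namespace OV

namespace Mesh

variable {a b : ℝ} {N : ℕ} [NeZero N] (M : Mesh a b N)

theorem deriv_f (z : ℝ) : deriv f z = z := by
  have : HasDerivAt f z z := by
    refine (((hasDerivAt_id z).pow 2).div_const 2).congr_deriv ?_
    simp
  exact this.deriv

/-- The error equation tested with the projected error, on one cell. -/
theorem error_equation {γ : ℝ} {U Ux V W : ℝ → ℝ} (hU : ∀ x, HasDerivAt U (Ux x) x)
    (hUx : Continuous Ux) (hV : ∀ x, HasDerivAt V (U x) x) (hUab : U a = U b)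
    (hbal : ∀ x, W x + U x * Ux x + γ * V x = 0) {g : Fin N → ℝ} {ω uh vh q ξ : ℝ[X]} {j : Fin N}
    (hq_orth : ∫ x in M.left j..M.right j, (V x - q.eval x) * ξ.eval x = 0)
    (hscheme : (∫ x in M.left j..M.right j, ω.eval x * ξ.eval x)
        + M.bdry g ξ j
        - (∫ x in M.left j..M.right j, f (uh.eval x) * ξ.derivative.eval x)
        + γ * (∫ x in M.left j..M.right j, vh.eval x * ξ.eval x) = 0) :
    ∫ x in M.left j..M.right j, (ω.eval x - W x) * ξ.eval x =
      -M.bdry (fun i => g i - f (U (M.right i))) ξ j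
        + (∫ x in M.left j..M.right j, (f (uh.eval x) - f (U x)) * ξ.derivative.eval x)
        - γ * ∫ x in M.left j..M.right j, (vh - q).eval x * ξ.eval x := by
  have hUc : Continuous U := continuous_iff_continuousAt.2 fun x => (hU x).continuousAt
  have hVc : Continuous V := continuous_iff_continuousAt.2 fun x => (hV x).continuousAt
  have hfU : Continuous fun x => f (U x) := by simp only [f]; fun_prop
  have hfu : Continuous fun x => f (uh.eval x) := by simp only [f]; fun_prop
  have hW : W = fun x => -(U x * Ux x) - γ * V x := by
    ext x; linarith [hbal x]
  have hWc : Continuous W := by rw [hW]; fun_prop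
  set l := M.left j
  set r := M.right j
  have hUl : U l = U (M.right (j - 1)) := by
    have := M.apply_left_succ hUab (j - 1)
    rwa [sub_add_cancel] at this
  have e4 : ∫ x in l..r, (U x * Ux x * ξ.eval x + f (U x) * ξ.derivative.eval x) =
      f (U r) * ξ.eval r - f (U l) * ξ.eval l := by
    refine intervalIntegral.integral_eq_sub_of_hasDerivAt
      (f := fun x => f (U x) * ξ.eval x) (fun x _ => ?_)
      (Continuous.intervalIntegrable (by fun_prop) _ _)
    have h1 : HasDerivAt (fun x => f (U x)) (U x * Ux x) x := by
      refine (((hU x).pow 2).div_const 2).congr_deriv ?_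
      push_cast; ring
    exact h1.mul (ξ.hasDerivAt x)
  have e6 : ∫ x in l..r, (ω.eval x - W x) * ξ.eval x =
      (∫ x in l..r, ω.eval x * ξ.eval x)
      + (∫ x in l..r, (U x * Ux x * ξ.eval x + f (U x) * ξ.derivative.eval x))
      - (∫ x in l..r, f (uh.eval x) * ξ.derivative.eval x)
      + (∫ x in l..r, (f (uh.eval x) - f (U x)) * ξ.derivative.eval x)
      + γ * (∫ x in l..r, vh.eval x * ξ.eval x)
      - γ * (∫ x in l..r, (vh - q).eval x * ξ.eval x)
      + γ * (∫ x in l..r, (V x - q.eval x) * ξ.eval x) := by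
    simp only [← intervalIntegral.integral_const_mul]
    rw [← intervalIntegral.integral_add, ← intervalIntegral.integral_sub,
      ← intervalIntegral.integral_add, ← intervalIntegral.integral_add,
      ← intervalIntegral.integral_sub, ← intervalIntegral.integral_add]
    · congr 1; ext x; simp only [eval_sub, hW]; ring
    all_goals exact Continuous.intervalIntegrable (by fun_prop) _ _
  rw [e6, e4, hq_orth, hUl]
  simp only [bdry] at hscheme ⊢
  linarith

/-- Differential inequality for the projected error at a fixed time. -/
theorem energy_inequality {γ B c ε K : ℝ} {k : ℕ}
    (hK : ∀ p : ℝ[X], p.natDegree ≤ k → ∀ l r : ℝ, l < r → ∀ x ∈ Set.Icc l r,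
      p.eval x ^ 2 * (r - l) ≤ K * ∫ y in l..r, p.eval y ^ 2 ∧
      p.derivative.eval x ^ 2 * (r - l) ^ 3 ≤ K * ∫ y in l..r, p.eval y ^ 2)
    (hK0 : 0 ≤ K)
    {U Ux V W : ℝ → ℝ} (hU : ∀ x, HasDerivAt U (Ux x) x)
    (hUx : Continuous Ux) (hV : ∀ x, HasDerivAt V (U x) x) (hUab : U a = U b) (hVab : V a = V b)
    (hbal : ∀ x, W x + U x * Ux x + γ * V x = 0)
    (hB : ∀ x ∈ Set.Icc a b, |U x| ≤ B) (hBx : ∀ x ∈ Set.Icc a b, |Ux x| ≤ B)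
    {α : Fin N → ℝ} {ω uh vh p q : Fin N → ℝ[X]}
    (huh : IsDG k uh) (hvh : IsDG k vh) (hp : IsDG k p) (hq : IsDG k q)
    (hp_orth : ∀ j, ∀ φ : ℝ[X], φ.natDegree ≤ k →
      ∫ x in M.left j..M.right j, (U x - (p j).eval x) * φ.eval x = 0)
    (hq_orth : ∀ j, ∀ φ : ℝ[X], φ.natDegree ≤ k →
      ∫ x in M.left j..M.right j, (V x - (q j).eval x) * φ.eval x = 0)
    (hpε : ∀ j, ∀ x ∈ Set.Icc (M.left j) (M.right j), |U x - (p j).eval x| ≤ ε)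
    (hqε : ∀ j, ∀ x ∈ Set.Icc (M.left j) (M.right j), |V x - (q j).eval x| ≤ ε)
    (hc : ∀ j, ε ≤ c * M.width j)
    (hα : M.IsLFCoeff uh α)
    (hevol : ∀ j, ∀ φ : ℝ[X], φ.natDegree ≤ k →
      (∫ x in M.left j..M.right j, (ω j).eval x * φ.eval x)
        + M.bdry (M.lfFlux α uh) φ j
        - (∫ x in M.left j..M.right j, f ((uh j).eval x) * φ.derivative.eval x)
        + γ * (∫ x in M.left j..M.right j, (vh j).eval x * φ.eval x) = 0)
    (hpot : ∀ j, ∀ φ : ℝ[X], φ.natDegree ≤ k →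
      M.bdry (M.vFlux γ vh) φ j
          - (∫ x in M.left j..M.right j, (vh j).eval x * φ.derivative.eval x)
        = ∫ x in M.left j..M.right j, (uh j).eval x * φ.eval x) :
    ∑ j, ∫ x in M.left j..M.right j, ((ω j).eval x - W x) * (uh j - p j).eval x ≤
      (B / 2 + 2 * K + 3 * c ^ 2 / 2 + 2 * c * K) *
          (∑ j, ∫ x in M.left j..M.right j, (uh j - p j).eval x ^ 2)
        + (3 * (B + c * (b - a)) + 3 / 2 * c ^ 2 * (b - a) + c * (b - a) / 4
          + 3 / 2 * (B ^ 2 + c ^ 2) * (b - a) + |γ| / 2) * (N * ε ^ 2) := by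
  have hUc : Continuous U := continuous_iff_continuousAt.2 fun x => (hU x).continuousAt
  have hl : ∀ j, M.left j ∈ Set.Icc (M.left j) (M.right j) := fun j =>
    ⟨le_rfl, (M.left_lt_right j).le⟩
  have hr : ∀ j, M.right j ∈ Set.Icc (M.left j) (M.right j) := fun j =>
    ⟨(M.left_lt_right j).le, le_rfl⟩
  have hε0 : 0 ≤ ε := (abs_nonneg _).trans (hpε 0 _ (hl 0))
  have hc0 : 0 ≤ c := by
    by_contra! h
    nlinarith [hc 0, M.width_pos 0]
  have hN1 : (1 : ℝ) ≤ N := by exact_mod_cast NeZero.one_le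
  have hNε : N * ε ≤ c * (b - a) := by
    rw [← M.sum_width, Finset.mul_sum]
    calc (N : ℝ) * ε = ∑ _j : Fin N, ε := by simp
      _ ≤ _ := Finset.sum_le_sum fun j _ => hc j
  have hεc : ε ≤ c * (b - a) := (le_mul_of_one_le_left hε0 hN1).trans hNε
  set ξ : Fin N → ℝ[X] := uh - p with hξ
  have hξj : ∀ j, uh j - p j = ξ j := fun j => rfl
  have hdeg : ∀ j, (ξ j).natDegree ≤ k := fun j =>
    (natDegree_sub_le _ _).trans (max_le (huh j) (hp j))
  have hpξ : ∀ j, p j + ξ j = uh j := fun j => by rw [← hξj]; ring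
  set e : Fin N → ℝ := fun j => ∫ x in M.left j..M.right j, (ξ j).eval x ^ 2 with he
  set E := ∑ j, e j with hE
  have he0 : ∀ j, 0 ≤ e j := fun j =>
    intervalIntegral.integral_nonneg (M.left_lt_right j).le fun x _ => sq_nonneg _
  have heE : ∀ j, e j ≤ E := fun j => Finset.single_le_sum (fun i _ => he0 i) (Finset.mem_univ j)
  set J : Fin N → ℝ := fun j => M.tracePlus ξ j - M.traceMinus ξ j with hJ
  have hv := M.potential_estimate (p := p) hUc hV hVab hvh hq hp_orth hq_orth hqε hpot
  simp only [hξj] at hv ⊢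
  have hvol := fun j =>
    volume_estimate (fun p hp l r hlr x hx => (hK p hp l r hlr x hx).2) (M.left_lt_right j)
      hU hUx (fun x hx => hBx x (M.cell_subset j hx)) (hdeg j) (hp_orth j) (hpε j) (hc j)
  simp only [hpξ] at hvol
  -- The subtracted bracket is the node contribution of the exact cell integration in `hvol`; it
  -- must be combined with the flux before estimating.
  have hnode : ∀ j, (M.lfFlux α uh j - f (U (M.right j))) * J j
      - (U (M.right j) * (M.tracePlus ξ j ^ 2 - M.traceMinus ξ j ^ 2) / 2
        + (M.tracePlus ξ j ^ 3 - M.traceMinus ξ j ^ 3) / 6) ≤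
      3 * α j * ε ^ 2 + ε * J j ^ 2 / 2 + ε ^ 3 / 4 := by
    intro j
    have h1 : |M.tracePlus uh j| ≤ α j := by
      have := (hα j).1 _ Set.right_mem_uIcc
      rwa [deriv_f] at this
    have h2 : |M.traceMinus uh j| ≤ α j := by
      have := (hα j).1 _ Set.left_mem_uIcc
      rwa [deriv_f] at this
    have h3 : |U (M.right j) + M.tracePlus ξ j - M.tracePlus uh j| ≤ ε := by
      have := hpε (j + 1) _ (hl _)
      rw [M.apply_left_succ hUab] at this
      convert this using 2
      simp [tracePlus, hξ]; ring
    have h4 : |U (M.right j) + M.traceMinus ξ j - M.traceMinus uh j| ≤ ε := by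
      have := hpε j _ (hr _)
      convert this using 2
      simp [traceMinus, hξ]; ring
    have := interface_estimate hε0 h1 h2 h3 h4
    simp only [lfFlux, hJ]
    linarith
  -- Here ε ≤ c · width compensates the factor 1/width of the inverse inequality for traces.
  have hJ2 : ∀ j, ε * J j ^ 2 / 2 ≤ c * K * e (j + 1) + c * K * e j := by
    intro j
    have key : ∀ i, ∀ x ∈ Set.Icc (M.left i) (M.right i), ε * (ξ i).eval x ^ 2 ≤ c * K * e i := by
      intro i x hx
      calc ε * (ξ i).eval x ^ 2 ≤ (c * M.width i) * (ξ i).eval x ^ 2 := by gcongr; exact hc i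
        _ = c * ((ξ i).eval x ^ 2 * (M.right i - M.left i)) := by rw [width]; ring
        _ ≤ c * (K * e i) := by
          exact mul_le_mul_of_nonneg_left (hK _ (hdeg i) _ _ (M.left_lt_right i) x hx).1 hc0
        _ = _ := by ring
    have h1 := key _ _ (hl (j + 1))
    have h2 := key _ _ (hr j)
    have h3 : J j ^ 2 ≤ 2 * ((ξ (j + 1)).eval (M.left (j + 1)) ^ 2 + (ξ j).eval (M.right j) ^ 2) := by
      simp only [hJ, tracePlus, traceMinus]
      nlinarith [sq_nonneg ((ξ (j + 1)).eval (M.left (j + 1)) + (ξ j).eval (M.right j))]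
    have := mul_le_mul_of_nonneg_left h3 hε0
    linarith
  -- All the α j may be attained in the same cell, so each is bounded with the full energy E. The
  -- factor N anticipates the sum over j and is cancelled in `hαsum`.
  have hαj : ∀ j, N * (3 * α j * ε ^ 2) ≤
      3 * (B + c * (b - a)) * (N * ε ^ 2) + 3 / 2 * (c ^ 2 * (b - a) * (N * ε ^ 2) + K * E) := by
    intro j
    obtain ⟨i, x, hx, hi⟩ := (hα j).2
    rw [deriv_f] at hi
    have h1 : |(uh i).eval x| ≤ B + ε + |(ξ i).eval x| := by
      have e1 : (uh i).eval x = U x - (U x - (p i).eval x) + (ξ i).eval x := by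
        simp [hξ]
      rw [e1]
      refine (abs_add_le _ _).trans ?_
      gcongr
      exact (abs_sub _ _).trans (add_le_add (hB x (M.cell_subset i hx)) (hpε i x hx))
    have hw := M.width_pos i
    have h2 : M.width i * (ξ i).eval x ^ 2 ≤ K * E := by
      have := (hK _ (hdeg i) _ _ (M.left_lt_right i) x hx).1
      rw [mul_comm]
      exact this.trans (by gcongr; exact heE i)
    -- Young's inequality weighted by √width: one square is bounded by KE, the other by a multiple
    -- of Nε², since Nε and ε/width are bounded.
    have h3 : 2 * ((N * ε ^ 2) * |(ξ i).eval x|) ≤ c ^ 2 * (b - a) * (N * ε ^ 2) + K * E := by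
      have e1 := two_mul_le_add_sq (√(M.width i) * |(ξ i).eval x|) (N * ε ^ 2 / √(M.width i))
      have hs := Real.sq_sqrt hw.le
      have hs0 := Real.sqrt_pos.2 hw
      rw [mul_pow, div_pow, hs, sq_abs] at e1
      have e2 : 2 * (√(M.width i) * |(ξ i).eval x|) * (N * ε ^ 2 / √(M.width i)) =
          2 * ((N * ε ^ 2) * |(ξ i).eval x|) := by field_simp
      have e3 : (N * ε ^ 2) ^ 2 / M.width i ≤ c ^ 2 * (b - a) * (N * ε ^ 2) := by
        rw [div_le_iff₀ hw]
        calc (N * ε ^ 2) ^ 2 = (N * ε) * ε * (N * ε ^ 2) := by ring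
          _ ≤ (c * (b - a)) * (c * M.width i) * (N * ε ^ 2) := by
            have := hc i
            have : 0 ≤ c * (b - a) := hε0.trans hεc
            gcongr
          _ = _ := by ring
      linarith
    have h4 : N * (3 * α j * ε ^ 2) ≤ 3 * (N * ε ^ 2) * (B + c * (b - a) + |(ξ i).eval x|) := by
      have : α j ≤ B + c * (b - a) + |(ξ i).eval x| := by linarith
      calc N * (3 * α j * ε ^ 2) = 3 * (N * ε ^ 2) * α j := by ring
        _ ≤ _ := by gcongr
    linarith
  have hαsum : ∑ j, 3 * α j * ε ^ 2 ≤
      3 * (B + c * (b - a)) * (N * ε ^ 2) + 3 / 2 * (c ^ 2 * (b - a) * (N * ε ^ 2) + K * E) := by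
    have hN : (0 : ℝ) < N := by linarith
    refine le_of_mul_le_mul_left ?_ hN
    rw [Finset.mul_sum]
    calc _ ≤ ∑ _j : Fin N, _ := Finset.sum_le_sum fun j _ => hαj j
      _ = _ := by simp [mul_add]
  have hcells : ∑ j, ∫ x in M.left j..M.right j, ((ω j).eval x - W x) * (ξ j).eval x =
      (∑ j, (M.lfFlux α uh j - f (U (M.right j))) * J j)
      + (∑ j, ∫ x in M.left j..M.right j, (f ((uh j).eval x) - f (U x)) * (ξ j).derivative.eval x)
      - γ * ∑ j, ∫ x in M.left j..M.right j, (vh j - q j).eval x * (ξ j).eval x := by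
    rw [Finset.sum_congr rfl fun j _ => M.error_equation hU hUx hV hUab hbal
      (hq_orth j _ (hdeg j)) (hevol j _ (hdeg j)), Finset.sum_sub_distrib, Finset.sum_add_distrib,
      Finset.sum_neg_distrib, sum_bdry, neg_neg, ← Finset.mul_sum]
  have hvolsum := Finset.sum_le_sum fun j (_ : j ∈ Finset.univ) => hvol j
  rw [Finset.sum_add_distrib, Finset.sum_add_distrib, M.sum_boundary fun j x =>
    U x * (ξ j).eval x ^ 2 / 2 + (ξ j).eval x ^ 3 / 6, ← Finset.mul_sum, ← Finset.mul_sum] at hvolsum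
  have hwsum : ∑ j, (M.right j - M.left j) = b - a := M.sum_width
  rw [hwsum] at hvolsum
  have hbd : ∑ j, (U (M.left (j + 1)) * (ξ (j + 1)).eval (M.left (j + 1)) ^ 2 / 2
        + (ξ (j + 1)).eval (M.left (j + 1)) ^ 3 / 6
        - (U (M.right j) * (ξ j).eval (M.right j) ^ 2 / 2 + (ξ j).eval (M.right j) ^ 3 / 6)) =
      ∑ j, (U (M.right j) * (M.tracePlus ξ j ^ 2 - M.traceMinus ξ j ^ 2) / 2
        + (M.tracePlus ξ j ^ 3 - M.traceMinus ξ j ^ 3) / 6) := by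
    refine Finset.sum_congr rfl fun j _ => ?_
    rw [M.apply_left_succ hUab]
    simp only [tracePlus, traceMinus]
    ring
  rw [hbd, Finset.sum_add_distrib] at hvolsum
  have hnodesum := Finset.sum_le_sum fun j (_ : j ∈ Finset.univ) => hnode j
  rw [Finset.sum_sub_distrib, Finset.sum_add_distrib, Finset.sum_add_distrib,
    Finset.sum_add_distrib] at hnodesum
  have hJsum : ∑ j, ε * J j ^ 2 / 2 ≤ 2 * c * K * E := by
    calc _ ≤ ∑ j, (c * K * e (j + 1) + c * K * e j) := Finset.sum_le_sum fun j _ => hJ2 j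
      _ = _ := by
        rw [Finset.sum_add_distrib, sum_shift fun j => c * K * e j, ← Finset.mul_sum]; ring
  have hε3 : ∑ _j : Fin N, ε ^ 3 / 4 ≤ c * (b - a) / 4 * (N * ε ^ 2) := by
    have : (N * ε ^ 2) * ε ≤ (N * ε ^ 2) * (c * (b - a)) := by gcongr
    simp only [Finset.sum_const, Finset.card_univ, Fintype.card_fin, nsmul_eq_mul]
    linarith
  have hba : 0 ≤ b - a := by
    rw [← M.sum_width]; exact Finset.sum_nonneg fun j _ => (M.width_pos j).le
  have hε2 : 3 / 2 * (B ^ 2 + c ^ 2) * ε ^ 2 * (b - a) ≤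
      3 / 2 * (B ^ 2 + c ^ 2) * (b - a) * (N * ε ^ 2) := by
    have : ε ^ 2 ≤ N * ε ^ 2 := le_mul_of_one_le_left (sq_nonneg _) hN1
    calc _ = 3 / 2 * (B ^ 2 + c ^ 2) * (b - a) * ε ^ 2 := by ring
      _ ≤ _ := by gcongr
  have hEsum : ∑ j, ∫ x in M.left j..M.right j, (ξ j).eval x ^ 2 = E := rfl
  rw [hEsum] at hvolsum ⊢
  rw [hcells]
  linarith

end Mesh

end OV

/-! ### Time dependence: Gronwall's inequality, derivatives on the strip, moments. -/

namespace OV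

open Set Filter Topology MeasureTheory

theorem integral_sq_ofCoeffs {k : ℕ} (l r : ℝ) (c : Fin (k + 1) → ℝ) :
    ∫ x in l..r, (ofCoeffs c).eval x ^ 2 = ∑ i, c i * ∑ m, gram k l r i m * c m := by
  simp only [sq]
  rw [integral_mul_ofCoeffs ((ofCoeffs c).continuous.intervalIntegrable _ _)]
  simp only [← gram_mulVec]
  rfl

theorem continuousOn_integral_sq {k : ℕ} (l r : ℝ) {p : ℝ → ℝ[X]} {s : Set ℝ}
    (hdeg : ∀ t ∈ s, (p t).natDegree ≤ k) (h : ∀ i, ContinuousOn (fun t => (p t).coeff i) s) :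
    ContinuousOn (fun t => ∫ x in l..r, (p t).eval x ^ 2) s := by
  have : ContinuousOn (fun t => ∑ i : Fin (k + 1), (p t).coeff i *
      ∑ m : Fin (k + 1), gram k l r i m * (p t).coeff m) s :=
    continuousOn_finsetSum _ fun i _ => (h i).mul
      (continuousOn_finsetSum _ fun m _ => continuousOn_const.mul (h m))
  refine this.congr fun t ht => ?_
  have h1 := integral_sq_ofCoeffs l r fun i : Fin (k + 1) => (p t).coeff i
  rwa [ofCoeffs_coeff (hdeg t ht)] at h1

/-- The integral is a quadratic form in the coefficients with a fixed symmetric matrix, so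
coefficientwise derivatives suffice. -/
theorem hasDerivAt_integral_sq {k : ℕ} (l r : ℝ) {p : ℝ → ℝ[X]} {w : ℝ[X]} {t : ℝ}
    (hdeg : ∀ᶠ s in 𝓝 t, (p s).natDegree ≤ k)
    (h : ∀ i, HasDerivAt (fun s => (p s).coeff i) (w.coeff i) t) :
    HasDerivAt (fun s => ∫ x in l..r, (p s).eval x ^ 2)
      (2 * ∫ x in l..r, w.eval x * (p t).eval x) t := by
  -- The degree bound is forced: the coefficients of `w` above k are derivatives of functions
  -- vanishing near t.
  have hw : w.natDegree ≤ k := by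
    refine natDegree_le_iff_coeff_eq_zero.2 fun i hi => ?_
    refine (h i).unique ((hasDerivAt_const t (0 : ℝ)).congr_of_eventuallyEq ?_)
    filter_upwards [hdeg] with s hs
    exact coeff_eq_zero_of_natDegree_lt (hs.trans_lt hi)
  have hpt := hdeg.self_of_nhds
  have h1 : HasDerivAt (fun s => ∑ i : Fin (k + 1), (p s).coeff i *
      ∑ m : Fin (k + 1), gram k l r i m * (p s).coeff m)
      (∑ i : Fin (k + 1), (w.coeff i * (∑ m : Fin (k + 1), gram k l r i m * (p t).coeff m)
        + (p t).coeff i * ∑ m : Fin (k + 1), gram k l r i m * w.coeff m)) t :=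
    HasDerivAt.fun_sum fun i _ => (h i).mul (HasDerivAt.fun_sum fun m _ => (h m).const_mul _)
  have key : ∀ q q' : ℝ[X], q.natDegree ≤ k → q'.natDegree ≤ k →
      ∑ i : Fin (k + 1), q'.coeff i * ∑ m : Fin (k + 1), gram k l r i m * q.coeff m =
        ∫ x in l..r, q.eval x * q'.eval x := by
    intro q q' hq hq'
    have := integral_mul_ofCoeffs (l := l) (r := r) (q.continuous.intervalIntegrable l r)
      (fun i : Fin (k + 1) => q'.coeff i)
    rw [ofCoeffs_coeff hq'] at this
    rw [this]
    refine Finset.sum_congr rfl fun i _ => ?_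
    congr 1
    have := gram_mulVec k l r (fun i : Fin (k + 1) => q.coeff i) i
    rw [ofCoeffs_coeff hq] at this
    rw [← this]
    rfl
  refine (h1.congr_of_eventuallyEq ?_).congr_deriv ?_
  · filter_upwards [hdeg] with s hs
    rw [← integral_sq_ofCoeffs l r fun i : Fin (k + 1) => (p s).coeff i, ofCoeffs_coeff hs]
  · rw [Finset.sum_add_distrib, key _ _ hpt hw, key _ _ hw hpt, two_mul]
    congr 2
    ext x; ring

/-- Gronwall's inequality for a continuous function that is differentiable inside the interval. -/
theorem gronwall_of_interior_deriv {E : ℝ → ℝ} {T A R : ℝ} (hA : 0 ≤ A) (hR : 0 ≤ R)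
    (hc : ContinuousOn E (Icc 0 T))
    (hd : ∀ t ∈ Ioo 0 T, ∃ E', HasDerivAt E E' t ∧ E' ≤ A * E t + R) {t : ℝ} (ht : t ∈ Icc 0 T)
    (hE0 : 0 ≤ E 0) : E t ≤ Real.exp (A * T) * (E 0 + R * T) := by
  -- Subtracting R s is enough because the integrating factor is at most 1 for s ≥ 0.
  set F : ℝ → ℝ := fun s => Real.exp (-(A * s)) * E s - R * s with hF
  have hFd : ∀ s ∈ Ioo 0 T, ∃ F', HasDerivAt F F' s ∧ F' ≤ 0 := by
    intro s hs
    obtain ⟨E', hE', hle⟩ := hd s hs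
    have h1 : HasDerivAt (fun s => Real.exp (-(A * s))) (Real.exp (-(A * s)) * -(A * 1)) s :=
      (((hasDerivAt_id s).const_mul A).neg).exp
    refine ⟨_, (h1.mul hE').sub ((hasDerivAt_id s).const_mul R), ?_⟩
    have h2 : Real.exp (-(A * s)) ≤ 1 := Real.exp_le_one_iff.2 (by nlinarith [hs.1])
    have h3 := Real.exp_pos (-(A * s))
    nlinarith [mul_le_mul_of_nonneg_left hle h3.le, mul_le_mul_of_nonneg_right h2 hR]
  have hanti : AntitoneOn F (Icc 0 T) := by
    refine antitoneOn_of_deriv_nonpos (convex_Icc 0 T) ?_ ?_ ?_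
    · exact ((by fun_prop : Continuous fun s => Real.exp (-(A * s))).continuousOn.mul hc).sub
        (by fun_prop)
    · rw [interior_Icc]
      intro s hs
      obtain ⟨F', hF', -⟩ := hFd s hs
      exact hF'.differentiableAt.differentiableWithinAt
    · rw [interior_Icc]
      intro s hs
      obtain ⟨F', hF', hle⟩ := hFd s hs
      rwa [hF'.deriv]
  have h0T : 0 ≤ T := ht.1.trans ht.2
  have h1 := hanti (left_mem_Icc.2 h0T) ht ht.1
  simp only [hF, mul_zero, neg_zero, Real.exp_zero, one_mul, sub_zero] at h1
  have h2 : E t = Real.exp (A * t) * (Real.exp (-(A * t)) * E t) := by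
    rw [← mul_assoc, ← Real.exp_add]; simp
  rw [h2]
  have h3 : Real.exp (-(A * t)) * E t ≤ E 0 + R * T := by
    have := mul_le_mul_of_nonneg_left ht.2 hR
    linarith
  calc _ ≤ Real.exp (A * t) * (E 0 + R * T) := by gcongr
    _ ≤ _ := by
      gcongr
      exact ht.2

theorem uniqueDiffOn_strip {T : ℝ} (hT : 0 < T) :
    UniqueDiffOn ℝ (Icc 0 T ×ˢ (univ : Set ℝ)) :=
  (uniqueDiffOn_Icc hT).prod uniqueDiffOn_univ

/-- Partial derivatives in `x` of a function of class `C^m` on a strip. -/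
theorem exists_space_derivatives {T : ℝ} (hT : 0 < T) {m : ℕ} {u : ℝ → ℝ → ℝ}
    (hu : ContDiffOn ℝ (m : WithTop ℕ∞) (fun p : ℝ × ℝ => u p.1 p.2) (Icc 0 T ×ˢ univ)) :
    ∃ D : ℕ → ℝ → ℝ → ℝ, D 0 = u ∧
      (∀ i ≤ m, ContinuousOn (fun p : ℝ × ℝ => D i p.1 p.2) (Icc 0 T ×ˢ univ)) ∧
      ∀ i < m, ∀ t ∈ Icc 0 T, ∀ x, HasDerivAt (D i t) (D (i + 1) t x) x := by
  set S : Set (ℝ × ℝ) := Icc 0 T ×ˢ univ with hS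
  let step : (ℝ → ℝ → ℝ) → ℝ → ℝ → ℝ := fun w t x =>
    fderivWithin ℝ (fun p : ℝ × ℝ => w p.1 p.2) S (t, x) (0, 1)
  have hsm : ∀ i n : ℕ, i + n = m →
      ContDiffOn ℝ (n : WithTop ℕ∞) (fun p : ℝ × ℝ => (step^[i] u) p.1 p.2) S := by
    intro i
    induction i with
    | zero => intro n hn; simpa [← hn] using hu
    | succ i ih =>
      intro n hn
      have := (ih (n + 1) (by omega)).fderivWithin (m := (n : WithTop ℕ∞)) (uniqueDiffOn_strip hT)
        (by push_cast; rfl)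
      simp only [Function.iterate_succ_apply']
      exact this.clm_apply contDiffOn_const
  refine ⟨fun i => step^[i] u, rfl, fun i hi => (hsm i (m - i) (by omega)).continuousOn, ?_⟩
  intro i hi t ht x
  have h1 := (hsm i (m - i) (by omega)).differentiableOn
    (by exact_mod_cast (by omega : m - i ≠ 0)) (t, x) ⟨ht, mem_univ _⟩
  have h2 : HasDerivAt (fun y : ℝ => (t, y)) (0, 1) x := (hasDerivAt_const x t).prodMk (hasDerivAt_id x)
  -- The whole line at time t lies in the strip, so the x-derivative is two-sided even for t = 0 and
  -- t = T.
  have h3 := h1.hasFDerivWithinAt.comp_hasDerivWithinAt (s := univ) x h2.hasDerivWithinAt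
    (fun y _ => mk_mem_prod ht (mem_univ y))
  rw [hasDerivWithinAt_univ] at h3
  simp only [Function.iterate_succ_apply']
  exact h3

/-- The time derivative of a function of class `C¹` on a strip. -/
theorem exists_time_derivative {T : ℝ} (hT : 0 < T) {u : ℝ → ℝ → ℝ}
    (hu : ContDiffOn ℝ 1 (fun p : ℝ × ℝ => u p.1 p.2) (Icc 0 T ×ˢ univ)) :
    ∃ D : ℝ → ℝ → ℝ, ContinuousOn (fun p : ℝ × ℝ => D p.1 p.2) (Icc 0 T ×ˢ univ) ∧
      ∀ t ∈ Icc 0 T, ∀ x, HasDerivWithinAt (fun s => u s x) (D t x) (Icc 0 T) t := by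
  refine ⟨fun t x => fderivWithin ℝ (fun p : ℝ × ℝ => u p.1 p.2) (Icc 0 T ×ˢ univ) (t, x) (1, 0),
    ?_, fun t ht x => ?_⟩
  · exact (hu.continuousOn_fderivWithin (uniqueDiffOn_strip hT) le_rfl).clm_apply continuousOn_const
  · have h1 := hu.differentiableOn one_ne_zero (t, x) ⟨ht, mem_univ _⟩
    have h2 : HasDerivAt (fun s : ℝ => (s, x)) (1, 0) t :=
      (hasDerivAt_id t).prodMk (hasDerivAt_const t x)
    exact h1.hasFDerivWithinAt.comp_hasDerivWithinAt (s := Icc 0 T) t h2.hasDerivWithinAt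
      (fun s hs => mk_mem_prod hs (mem_univ x))

theorem continuous_slice {T t : ℝ} (ht : t ∈ Icc 0 T) {w : ℝ → ℝ → ℝ}
    (hw : ContinuousOn (fun p : ℝ × ℝ => w p.1 p.2) (Icc 0 T ×ˢ univ)) : Continuous (w t) := by
  rw [← continuousOn_univ]
  exact hw.comp (f := fun x => (t, x)) (by fun_prop) fun x _ => ⟨ht, mem_univ _⟩

theorem continuousOn_moment {T : ℝ} (hT : 0 < T) {u : ℝ → ℝ → ℝ} (l r : ℝ)
    (hu : ContinuousOn (fun p : ℝ × ℝ => u p.1 p.2) (Icc 0 T ×ˢ univ)) (i : ℕ) :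
    ContinuousOn (fun t => ∫ x in l..r, u t x * x ^ i) (Icc 0 T) := by
  -- Clamping time to [0, T] makes the integrand globally continuous without changing it on the
  -- strip.
  have h1 : Continuous fun p : ℝ × ℝ => u (projIcc 0 T hT.le p.1) p.2 := by
    rw [← continuousOn_univ]
    exact hu.comp (f := fun p : ℝ × ℝ => ((projIcc 0 T hT.le p.1 : ℝ), p.2))
      (by fun_prop) fun p _ => ⟨(projIcc 0 T hT.le p.1).2, mem_univ _⟩
  have h2 : Continuous fun t => ∫ x in l..r, u (projIcc 0 T hT.le t) x * x ^ i :=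
    intervalIntegral.continuous_parametric_intervalIntegral_of_continuous'
      (f := fun t x => u (projIcc 0 T hT.le t) x * x ^ i)
      (h1.mul (by fun_prop)) l r
  refine h2.continuousOn.congr fun t ht => ?_
  simp only [projIcc_of_mem hT.le ht]

theorem hasDerivAt_moment {T : ℝ} {u ut : ℝ → ℝ → ℝ} {l r : ℝ}
    (hu : ContinuousOn (fun p : ℝ × ℝ => u p.1 p.2) (Icc 0 T ×ˢ univ))
    (hut : ContinuousOn (fun p : ℝ × ℝ => ut p.1 p.2) (Icc 0 T ×ˢ univ))
    (hd : ∀ t ∈ Icc 0 T, ∀ x, HasDerivWithinAt (fun s => u s x) (ut t x) (Icc 0 T) t)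
    {t : ℝ} (ht : t ∈ Ioo 0 T) (i : ℕ) :
    HasDerivAt (fun s => ∫ x in l..r, u s x * x ^ i) (∫ x in l..r, ut t x * x ^ i) t := by
  have hc : ContinuousOn (fun p : ℝ × ℝ => ut p.1 p.2 * p.2 ^ i) (Icc 0 T ×ˢ uIcc l r) :=
    (hut.mono (prod_mono_right (subset_univ _))).mul (by fun_prop)
  obtain ⟨C, hC⟩ := (isCompact_Icc.prod isCompact_uIcc).exists_bound_of_continuousOn hc
  have hmem : Ioo 0 T ∈ 𝓝 t := Ioo_mem_nhds ht.1 ht.2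
  have hcs : ∀ {w : ℝ → ℝ → ℝ}, ContinuousOn (fun p : ℝ × ℝ => w p.1 p.2) (Icc 0 T ×ˢ univ) →
      ∀ s ∈ Ioo 0 T, Continuous fun x => w s x * x ^ i := fun hw s hs =>
    (continuous_slice (Ioo_subset_Icc_self hs) hw).mul (by fun_prop)
  refine (intervalIntegral.hasDerivAt_integral_of_dominated_loc_of_deriv_le
    (F := fun s x => u s x * x ^ i) (F' := fun s x => ut s x * x ^ i) (bound := fun _ => C)
    hmem ?_ ((hcs hu t ht).intervalIntegrable _ _) (hcs hut t ht).aestronglyMeasurable ?_ (by simp)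
    ?_).2
  · filter_upwards [hmem] with s hs
    exact (hcs hu s hs).aestronglyMeasurable
  · exact Eventually.of_forall fun x hx s hs =>
      hC (s, x) ⟨Ioo_subset_Icc_self hs, uIoc_subset_uIcc hx⟩
  · exact Eventually.of_forall fun x hx s hs =>
      ((hd s (Ioo_subset_Icc_self hs) x).hasDerivAt (Icc_mem_nhds hs.1 hs.2)).mul_const _

end OV

/-! ### The projected error as a function of time. -/

namespace OV

open Set Filter Topology MeasureTheory

theorem abs_sub_proj_le_of_derivatives {k : ℕ} {K : ℝ}
    (hK : ∀ p : ℝ[X], p.natDegree ≤ k → ∀ l r : ℝ, l < r → ∀ x ∈ Icc l r,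
      p.eval x ^ 2 * (r - l) ≤ K * ∫ y in l..r, p.eval y ^ 2)
    (hK0 : 0 ≤ K) {D : ℕ → ℝ → ℝ} {l r B h : ℝ} (hlr : l < r) (hrh : r - l ≤ h)
    (hD : ∀ i ≤ k, ∀ x ∈ Icc l r, HasDerivAt (D i) (D (i + 1) x) x)
    (hB : ∀ x ∈ Icc l r, |D (k + 1) x| ≤ B) {x : ℝ} (hx : x ∈ Icc l r) :
    |D 0 x - (proj k l r (D 0)).eval x| ≤ (1 + √K) * B * h ^ (k + 1) := by
  obtain ⟨q, hq, hqe⟩ := exists_polynomial_approx k D l r B hD hB hlr.le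
  have hB0 : 0 ≤ B := (abs_nonneg _).trans (hB x hx)
  have hd : 0 ≤ r - l := (sub_pos.2 hlr).le
  refine (abs_sub_proj_le hK hK0 hlr
    (fun y hy => (hD 0 (Nat.zero_le _) y hy).continuousAt.continuousWithinAt) hq hqe hx).trans ?_
  rw [mul_assoc]
  gcongr

theorem integral_sub_proj_mul {k : ℕ} {l r : ℝ} (hlr : l < r) {g : ℝ → ℝ}
    (hg : Continuous g) {φ : ℝ[X]} (hφ : φ.natDegree ≤ k) :
    ∫ x in l..r, (g x - (proj k l r g).eval x) * φ.eval x = 0 := by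
  simp only [sub_mul]
  rw [intervalIntegral.integral_sub (Continuous.intervalIntegrable (by fun_prop) _ _)
    (Continuous.intervalIntegrable (by fun_prop) _ _),
    integral_proj_mul hlr (hg.intervalIntegrable _ _) hφ, sub_self]

/-- The difference of two projections is an admissible test function orthogonal to itself. This
identifies the projection in the initial condition with `proj`. -/
theorem eq_proj_of_orthogonal {k : ℕ} {l r : ℝ} (hlr : l < r) {g : ℝ → ℝ}
    (hg : Continuous g) {p : ℝ[X]} (hp : p.natDegree ≤ k)
    (horth : ∀ φ : ℝ[X], φ.natDegree ≤ k → ∫ x in l..r, (p.eval x - g x) * φ.eval x = 0) :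
    p = proj k l r g := by
  by_contra hne
  have hdeg : (p - proj k l r g).natDegree ≤ k :=
    (natDegree_sub_le _ _).trans (max_le hp (natDegree_proj_le _ _ _ _))
  refine (integral_sq_eval_pos (sub_ne_zero.2 hne) hlr).ne' ?_
  have h1 := horth _ hdeg
  have h2 := integral_sub_proj_mul hlr hg hdeg
  rw [← add_zero (0 : ℝ)]
  nth_rewrite 1 [← h1]
  rw [← h2, ← intervalIntegral.integral_add]
  · congr 1; ext x; simp only [eval_sub]; ring
  all_goals exact Continuous.intervalIntegrable (by fun_prop) _ _

namespace Mesh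

variable {a b : ℝ} {N : ℕ} (M : Mesh a b N)

/-- The cellwise `L²` projection. -/
noncomputable def projection (k : ℕ) (g : ℝ → ℝ) (j : Fin N) : ℝ[X] := proj k (M.left j) (M.right j) g

/-- The squared `L²` norm of the projected error. -/
noncomputable def energy (k : ℕ) (g : ℝ → ℝ) (w : Fin N → ℝ[X]) : ℝ :=
  ∑ j, ∫ x in M.left j..M.right j, (w j - M.projection k g j).eval x ^ 2

theorem energy_nonneg (k : ℕ) (g : ℝ → ℝ) (w : Fin N → ℝ[X]) : 0 ≤ M.energy k g w :=
  Finset.sum_nonneg fun j _ => intervalIntegral.integral_nonneg (M.left_lt_right j).le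
    fun _ _ => sq_nonneg _

theorem natDegree_error_le {k : ℕ} {w : Fin N → ℝ[X]} (hw : IsDG k w) (g : ℝ → ℝ) (j : Fin N) :
    (w j - M.projection k g j).natDegree ≤ k :=
  (natDegree_sub_le _ _).trans (max_le (hw j) (natDegree_proj_le _ _ _ _))

theorem continuousOn_energy {T : ℝ} (hT : 0 < T) {k : ℕ} {u : ℝ → ℝ → ℝ} {uh : ℝ → Fin N → ℝ[X]}
    (hu : ContinuousOn (fun p : ℝ × ℝ => u p.1 p.2) (Icc 0 T ×ˢ univ))
    (hdeg : ∀ t ∈ Icc 0 T, IsDG k (uh t))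
    (huh : ∀ j i, ContinuousOn (fun s => (uh s j).coeff i) (Icc 0 T)) :
    ContinuousOn (fun t => M.energy k (u t) (uh t)) (Icc 0 T) := by
  refine continuousOn_finsetSum _ fun j _ => ?_
  refine continuousOn_integral_sq _ _ (fun t ht => M.natDegree_error_le (hdeg t ht) _ j) fun i => ?_
  simp only [coeff_sub]
  exact (huh j i).sub (continuousOn_coeff_proj (continuousOn_moment hT _ _ hu) i)

/-- Projection commutes with the time derivative, and the projected error is a test function, so P
u_t may be replaced by u_t. The result is the left side of `energy_inequality`, doubled. -/
theorem hasDerivAt_energy {T : ℝ} {k : ℕ} {u ut : ℝ → ℝ → ℝ} {uh : ℝ → Fin N → ℝ[X]}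
    (hu : ContinuousOn (fun p : ℝ × ℝ => u p.1 p.2) (Icc 0 T ×ˢ univ))
    (hut : ContinuousOn (fun p : ℝ × ℝ => ut p.1 p.2) (Icc 0 T ×ˢ univ))
    (hd : ∀ t ∈ Icc 0 T, ∀ x, HasDerivWithinAt (fun s => u s x) (ut t x) (Icc 0 T) t)
    (hdeg : ∀ t ∈ Icc 0 T, IsDG k (uh t)) {t : ℝ} (ht : t ∈ Ioo 0 T) {ω : Fin N → ℝ[X]}
    (hω : ∀ j i, HasDerivWithinAt (fun s => (uh s j).coeff i) ((ω j).coeff i) (Icc 0 T) t) :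
    HasDerivAt (fun t => M.energy k (u t) (uh t))
      (2 * ∑ j, ∫ x in M.left j..M.right j,
        ((ω j).eval x - ut t x) * (uh t j - M.projection k (u t) j).eval x) t := by
  have htI := Ioo_subset_Icc_self ht
  have hmem : Icc 0 T ∈ 𝓝 t := Icc_mem_nhds ht.1 ht.2
  rw [Finset.mul_sum]
  refine HasDerivAt.fun_sum fun j _ => ?_
  have h1 := hasDerivAt_integral_sq (k := k) (M.left j) (M.right j)
    (p := fun s => uh s j - M.projection k (u s) j) (w := ω j - M.projection k (ut t) j) (t := t)
    (by filter_upwards [hmem] with s hs using M.natDegree_error_le (hdeg s hs) _ j)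
    (fun i => by
      simp only [coeff_sub]
      exact ((hω j i).hasDerivAt hmem).sub
        (hasDerivAt_coeff_proj (fun i => hasDerivAt_moment hu hut hd ht i) i))
  refine h1.congr_deriv ?_
  have hutc := continuous_slice htI hut
  have h2 := integral_sub_proj_mul (M.left_lt_right j) hutc (M.natDegree_error_le (hdeg t htI) (u t) j)
  rw [← sub_zero (∫ x in M.left j..M.right j, _ * _), ← h2, ← intervalIntegral.integral_sub]
  · congr 2; ext x; simp only [eval_sub, projection]; ring
  all_goals exact Continuous.intervalIntegrable (by fun_prop) _ _

theorem l2Dist_sq_le {k : ℕ} {g : ℝ → ℝ} (hg : Continuous g) {w : Fin N → ℝ[X]} {ε : ℝ}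
    (hε : ∀ j, ∀ x ∈ Icc (M.left j) (M.right j), |g x - (M.projection k g j).eval x| ≤ ε) :
    M.l2Dist g w ≤ √(2 * ε ^ 2 * (b - a) + 2 * M.energy k g w) := by
  refine Real.sqrt_le_sqrt ?_
  rw [← M.sum_width, energy, Finset.mul_sum, Finset.mul_sum, ← Finset.sum_add_distrib]
  refine Finset.sum_le_sum fun j _ => ?_
  calc ∫ x in M.left j..M.right j, (g x - (w j).eval x) ^ 2
      ≤ ∫ x in M.left j..M.right j,
          (2 * ε ^ 2 + 2 * (w j - M.projection k g j).eval x ^ 2) := by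
        refine intervalIntegral.integral_mono_on (M.left_lt_right j).le
          (Continuous.intervalIntegrable (by fun_prop) _ _)
          (Continuous.intervalIntegrable (by fun_prop) _ _) fun x hx => ?_
        have h1 : (g x - (M.projection k g j).eval x) ^ 2 ≤ ε ^ 2 := by
          rw [← sq_abs]; gcongr; exact hε j x hx
        rw [eval_sub]
        nlinarith [sq_nonneg ((g x - (M.projection k g j).eval x)
          + ((w j).eval x - (M.projection k g j).eval x))]
    _ = _ := by
        rw [intervalIntegral.integral_add (by simp) (Continuous.intervalIntegrable (by fun_prop) _ _),
          intervalIntegral.integral_const, intervalIntegral.integral_const_mul, smul_eq_mul, width]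
        ring

theorem energy_le_of_l2Norm_le {k : ℕ} {g : ℝ → ℝ} (hg : Continuous g) {p w : Fin N → ℝ[X]}
    (hp : M.IsL2Projection k g p) {δ : ℝ} (h : M.l2Norm (p - w) ≤ δ) :
    M.energy k g w ≤ δ ^ 2 := by
  have h1 : M.energy k g w = ∑ j, ∫ x in M.left j..M.right j, ((p - w) j).eval x ^ 2 := by
    refine Finset.sum_congr rfl fun j _ => ?_
    have : p j = M.projection k g j :=
      eq_proj_of_orthogonal (M.left_lt_right j) hg (hp.1 j) (hp.2 j)
    rw [← this]
    congr 1; ext x; simp only [Pi.sub_apply, eval_sub]; ring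
  have h2 : M.l2Norm (p - w) = √(M.energy k g w) := by rw [h1]; rfl
  rw [h2] at h
  exact (Real.sqrt_le_iff.1 h).2

end Mesh

theorem exists_uniform_bound {T a b : ℝ} {m : ℕ} {D : ℕ → ℝ → ℝ → ℝ}
    (hD : ∀ i ≤ m, ContinuousOn (fun p : ℝ × ℝ => D i p.1 p.2) (Icc 0 T ×ˢ univ)) :
    ∃ B, 0 ≤ B ∧ ∀ i ≤ m, ∀ t ∈ Icc 0 T, ∀ x ∈ Icc a b, |D i t x| ≤ B := by
  have h : ∀ i : Fin (m + 1), ∃ C, ∀ p ∈ Icc 0 T ×ˢ Icc a b, ‖D i p.1 p.2‖ ≤ C := fun i =>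
    (isCompact_Icc.prod isCompact_Icc).exists_bound_of_continuousOn
      ((hD i (Nat.lt_succ_iff.1 i.2)).mono (prod_mono_right (subset_univ _)))
  choose C hC using h
  refine ⟨∑ i, |C i|, Finset.sum_nonneg fun _ _ => abs_nonneg _, fun i hi t ht x hx => ?_⟩
  refine (hC ⟨i, Nat.lt_succ_iff.2 hi⟩ (t, x) ⟨ht, hx⟩).trans ((le_abs_self _).trans ?_)
  exact Finset.single_le_sum (f := fun i => |C i|) (fun _ _ => abs_nonneg _) (Finset.mem_univ _)

end OV

/-! ### Choice of constants and conclusion. -/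

theorem theorem1 (γ a b T : ℝ) (hγ : γ ≠ 0) (hab : a < b) (hT : 0 < T) (k : ℕ)
    (u v : ℝ → ℝ → ℝ) (huv : OV.IsSmoothPeriodicSolution γ a b T (k + 1) u v)
    (κ C₀ : ℝ) :
    ∃ C > 0, ∃ h₀ > 0, ∀ (N : ℕ) [NeZero N] (M : OV.Mesh a b N),
      M.IsRegular κ → M.size ≤ h₀ →
      ∀ (α : ℝ → Fin N → ℝ) (uh vh : ℝ → Fin N → Polynomial ℝ),
        M.IsSchemeSolution γ T k α uh vh →
        (∃ p : Fin N → Polynomial ℝ, M.IsL2Projection k (u 0) p ∧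
          M.l2Norm (p - uh 0) ≤ C₀ * M.size ^ ((k : ℝ) + 1 / 2)) →
        ∀ t ∈ Set.Icc 0 T, M.l2Dist (u t) (uh t) ≤ C * M.size ^ ((k : ℝ) + 1 / 2) := by
  obtain ⟨K, hK0, hK⟩ := OV.exists_inverse_inequality k
  have hK1 := fun p hp l r hlr x hx => (hK p hp l r hlr x hx).1
  obtain ⟨D, hDu, hDc, hDd⟩ := OV.exists_space_derivatives hT huv.smooth
  obtain ⟨ut, hutc, hutd⟩ := OV.exists_time_derivative hT
    (huv.smooth.of_le (by exact_mod_cast Nat.le_add_left 1 k))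
  obtain ⟨B, hB0, hB⟩ := OV.exists_uniform_bound (a := a) (b := b) hDc
  have huc := huv.smooth.continuousOn
  have hba : 0 < b - a := sub_pos.2 hab
  set L := (1 + √K) * B with hL
  have hL0 : 0 ≤ L := by positivity
  set c := L * |κ| with hc
  set A := B / 2 + 2 * K + 3 * c ^ 2 / 2 + 2 * c * K with hA
  have hA0 : 0 ≤ A := by positivity
  set A' := 3 * (B + c * (b - a)) + 3 / 2 * c ^ 2 * (b - a) + c * (b - a) / 4
    + 3 / 2 * (B ^ 2 + c ^ 2) * (b - a) + |γ| / 2 with hA'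
  have hA'0 : 0 ≤ A' := by positivity
  -- Chosen so that 2A'Nε² ≤ R h^(2k+1), using ε² = L² h^(2k+2) and N h ≤ |κ|(b - a).
  set R := 2 * A' * (|κ| * (b - a) * L ^ 2) with hR
  have hR0 : 0 ≤ R := by positivity
  -- Approximation error, Gronwall bound, and 1 to make the constant strictly positive.
  set Q := 2 * L ^ 2 * (b - a) + 2 * (Real.exp (2 * A * T) * (C₀ ^ 2 + R * T)) + 1 with hQ
  have hQ0 : 0 < Q := by positivity
  refine ⟨√Q, Real.sqrt_pos.2 hQ0, 1, one_pos, ?_⟩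
  intro N _ M hreg hsize α uh vh hsch ⟨p₀, hp₀, h_start⟩ t ht
  set h := M.size with hh
  have hh0 : 0 < h := M.size_pos
  have hpow : (h ^ ((k : ℝ) + 1 / 2)) ^ 2 = h ^ (2 * k + 1) := by
    rw [← Real.rpow_natCast, ← Real.rpow_mul hh0.le, ← Real.rpow_natCast]
    congr 1; push_cast; ring
  set ε := L * h ^ (k + 1) with hε
  have hε2 : ε ^ 2 = L ^ 2 * h ^ (2 * k + 1) * h := by rw [hε]; ring
  have hcell : ∀ j, M.right j - M.left j ≤ h := M.width_le_size
  have happ_u : ∀ s ∈ Set.Icc 0 T, ∀ j, ∀ x ∈ Set.Icc (M.left j) (M.right j),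
      |u s x - (M.projection k (u s) j).eval x| ≤ ε := by
    intro s hs j x hx
    have := OV.abs_sub_proj_le_of_derivatives (D := fun i => D i s) hK1 hK0.le (M.left_lt_right j)
      (hcell j) (fun i hi y _ => hDd i (by omega) s hs y)
      (fun y hy => hB (k + 1) le_rfl s hs y (M.cell_subset j hy)) hx
    simp only [hDu] at this
    exact this
  have happ_v : ∀ s ∈ Set.Icc 0 T, ∀ j, ∀ x ∈ Set.Icc (M.left j) (M.right j),
      |v s x - (M.projection k (v s) j).eval x| ≤ ε := by
    intro s hs j x hx
    -- The derivatives of v are v, u, u_x, …, so the one of order k + 1 is `D k`, already bounded by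
    -- `B`.
    refine OV.abs_sub_proj_le_of_derivatives (D := fun i => Nat.casesOn i (v s) fun n => D n s)
      hK1 hK0.le (M.left_lt_right j) (hcell j) (fun i hi y _ => ?_)
      (fun y hy => hB k (Nat.le_succ k) s hs y (M.cell_subset j hy)) hx
    cases i with
    | zero =>
      have := huv.potential s hs y
      rw [← hDu] at this
      exact this
    | succ n => exact hDd n (by omega) s hs y
  have hcε : ∀ j, ε ≤ c * M.width j := by
    intro j
    have h1 : h ≤ |κ| * M.width j :=
      (hreg j).trans (mul_le_mul_of_nonneg_right (le_abs_self κ) (M.width_pos j).le)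
    -- The only restriction on the mesh size is h ≤ 1, and this works for k = 0 as well.
    have h2 : h ^ (k + 1) ≤ h := pow_le_of_le_one hh0.le hsize (Nat.succ_ne_zero k)
    calc ε ≤ L * (|κ| * M.width j) := mul_le_mul_of_nonneg_left (h2.trans h1) hL0
      _ = _ := by rw [hc]; ring
  have hNε : 2 * A' * (N * ε ^ 2) ≤ R * h ^ (2 * k + 1) := by
    have h1 : N * h ≤ |κ| * (b - a) :=
      (M.card_mul_size_le hreg).trans (mul_le_mul_of_nonneg_right (le_abs_self κ) hba.le)
    calc 2 * A' * (N * ε ^ 2) = 2 * A' * L ^ 2 * h ^ (2 * k + 1) * (N * h) := by rw [hε2]; ring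
      _ ≤ 2 * A' * L ^ 2 * h ^ (2 * k + 1) * (|κ| * (b - a)) := by gcongr
      _ = _ := by rw [hR]; ring
  have hslice : ∀ s ∈ Set.Icc 0 T, Continuous (u s) := fun s hs => OV.continuous_slice hs huc
  have hcont : ContinuousOn (fun s => M.energy k (u s) (uh s)) (Set.Icc 0 T) := by
    refine M.continuousOn_energy hT huc hsch.uh_mem fun j i s hs => ?_
    obtain ⟨w, hw, -⟩ := hsch.evolution s hs j
    exact (hw i).continuousWithinAt
  have hderiv : ∀ s ∈ Set.Ioo 0 T, ∃ E', HasDerivAt (fun s => M.energy k (u s) (uh s)) E' s ∧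
      E' ≤ 2 * A * M.energy k (u s) (uh s) + R * h ^ (2 * k + 1) := by
    intro s hs
    have hsI := Set.Ioo_subset_Icc_self hs
    choose ω hω hevol using hsch.evolution s hsI
    refine ⟨_, M.hasDerivAt_energy huc hutc hutd hsch.uh_mem hs hω, ?_⟩
    have hUd : ∀ x, HasDerivAt (u s) (D 1 s x) x := fun x => by
      simpa only [hDu] using hDd 0 (Nat.succ_pos k) s hsI x
    have hvc : Continuous (v s) :=
      continuous_iff_continuousAt.2 fun x => (huv.potential s hsI x).continuousAt
    have hper : ∀ {g : ℝ → ℝ}, Function.Periodic g (b - a) → g a = g b := fun hg => by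
      simpa using (hg a).symm
    have hbal : ∀ x, ut s x + u s x * D 1 s x + γ * v s x = 0 := by
      intro x
      have h1 := huv.balance s hsI x
      rw [(hutd s hsI x).derivWithin (uniqueDiffOn_Icc hT s hsI)] at h1
      have h2 : HasDerivAt (fun y => OV.f (u s y)) (u s x * D 1 s x) x := by
        refine (((hUd x).pow 2).div_const 2).congr_deriv ?_
        push_cast; ring
      rwa [h2.deriv] at h1
    have key := M.energy_inequality (γ := γ) (B := B) (c := c) (ε := ε) hK hK0.le hUd
      (OV.continuous_slice hsI (hDc 1 (by omega))) (huv.potential s hsI)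
      (hper (huv.periodic_u s hsI)) (hper (huv.periodic_v s hsI)) hbal
      (fun x hx => by simpa only [hDu] using hB 0 (by omega) s hsI x hx)
      (hB 1 (by omega) s hsI)
      (p := M.projection k (u s)) (q := M.projection k (v s))
      (hsch.uh_mem s hsI) (hsch.vh_mem s hsI) (fun j => OV.natDegree_proj_le _ _ _ _)
      (fun j => OV.natDegree_proj_le _ _ _ _)
      (fun j φ hφ => OV.integral_sub_proj_mul (M.left_lt_right j) (hslice s hsI) hφ)
      (fun j φ hφ => OV.integral_sub_proj_mul (M.left_lt_right j) hvc hφ)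
      (happ_u s hsI) (happ_v s hsI) hcε (hsch.coeff s hsI) hevol (hsch.potential s hsI)
    rw [← hA, ← hA'] at key
    simp only [OV.Mesh.energy]
    linarith
  have h0I : (0 : ℝ) ∈ Set.Icc 0 T := ⟨le_rfl, hT.le⟩
  have hE0 : M.energy k (u 0) (uh 0) ≤ C₀ ^ 2 * h ^ (2 * k + 1) := by
    rw [← hpow, ← mul_pow]
    exact M.energy_le_of_l2Norm_le (hslice 0 h0I) hp₀ h_start
  have hEt := OV.gronwall_of_interior_deriv (by positivity) (by positivity) hcont hderiv ht
    (M.energy_nonneg k _ _)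
  refine (M.l2Dist_sq_le (hslice t ht) (happ_u t ht)).trans ?_
  rw [← Real.sqrt_sq (by positivity : 0 ≤ h ^ ((k : ℝ) + 1 / 2)), ← Real.sqrt_mul hQ0.le, hpow]
  refine Real.sqrt_le_sqrt ?_
  have h1 : 2 * ε ^ 2 * (b - a) ≤ 2 * L ^ 2 * (b - a) * h ^ (2 * k + 1) := by
    rw [hε2]
    calc _ = 2 * L ^ 2 * (b - a) * h ^ (2 * k + 1) * h := by ring
      _ ≤ _ := mul_le_of_le_one_right (by positivity) hsize
  have h2 : M.energy k (u t) (uh t) ≤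
      Real.exp (2 * A * T) * (C₀ ^ 2 + R * T) * h ^ (2 * k + 1) := by
    refine hEt.trans ?_
    calc _ ≤ Real.exp (2 * A * T) * (C₀ ^ 2 * h ^ (2 * k + 1) + R * h ^ (2 * k + 1) * T) := by
          gcongr
      _ = _ := by ring
  have h3 : 0 < h ^ (2 * k + 1) := by positivity
  rw [hQ]
  linarith
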